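/- **Setting.** Let $x=\{x_1,\dots,x_N\}$ be a data set partitioned into $S$ non-empty shards $\mathbf x_1,\dots,\mathbf x_S$ of sizes $N_1,\dots,N_S$, $N=\sum_s N_s$. Let $p(\theta)>0$ be a prior on $\mathbb R^d$ and $p(x_i\mid\theta)>0$ the likelihoods, all $C^3$ in $\theta$, with $p(\theta)\prod_i p(x_i\mid\theta)$ integrable, and let $p(\theta\mid x)\propto p(\theta)\prod_i p(x_i\mid\theta)$ be the posterior density. Let $f_s>0$, $\sum_s f_s=1$, $m\ge 1$. DSGLD with constant step size $h>0$ is the chain $$\theta_{t+1}=\theta_t+\tfrac h2\Big(\nabla\log p(\theta_t)+\tfrac{N_{s_t}}{f_{s_t}m}\sum_{y\in \mathbf x_{s_t}^{(m)}}\nabla\log p(y\mid\theta_t)\Big)+\eta_t,\qquad \eta_t\sim\mathcal N(0,hI),$$ where at each step $s_t$ is drawn with probabilities $f_1,\dots,f_S$, then a mini-batch $\mathbf x_{s_t}^{(m)}$ of $m$ points is drawn uniformly with replacement from shard $s_t$, and $\theta_0$, the draws and the Gaussian noises of all steps are independent. For a test function $\phi$ put $\hat\phi=T^{-1}\sum_{t=1}^T\phi(\theta_t)$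 and $\bar\phi=\int\phi(\theta)\,p(\theta\mid x)\,d\theta$ (assumed to converge absolutely). **Assumptions.** (a) $\|\nabla\log p(x_i\mid\theta)\|\le\gamma_s$ for all $\theta$, all $s$ and all $x_i\in\mathbf x_s$. (b) $\phi$ is $C^2$, and $\psi\in C^3$ solves the Poisson equation $\mathcal L\psi=\phi-\bar\phi$, where $\mathcal L\psi=\tfrac12\nabla\log p(\theta\mid x)\cdot\nabla\psi+\tfrac12\Delta\psi$. There are a measurable function $\Gamma\ge 0$, exponents $p_0,\dots,p_3,r,q>0$ and constants $C_k, C', C''_k$ with $\|D^k\psi\|\le C_k\Gamma^{p_k}$ ($0\le k\le 3$), $\|D^2\phi\|\le C'(1+\Gamma^{r})$ and $\|D^k\log p(\cdot\mid x)\|\le C''_k(1+\Gamma^{q})$ ($1\le k\le3$). (c) Let $R=2\max(p_0,p_1,p_2,p_3,r)+6q$. For each $0<\rho\le R$ there is a constant $c_\rho$ with $\Gamma^\rho(a\theta+(1-a)\theta')\le c_\rho(\Gamma^\rho(\theta)+\Gamma^\rho(\theta'))$ for all $\theta,\theta'$ and $a\in(0,1)$. (d) $H\subseteq(0,\infty)$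 is a set of step sizes such that $\sup_{h\in H}\sup_{t\ge0}\mathbb E\,\Gamma^\rho(\theta_t)<\infty$ for each $0<\rho\le R$. **Conclusion.** There is a constant $C>0$, independent of $T$ and $h$, such that for all $h\in H$ and all $T\ge1$ the mean squared error is finite and $$\mathbb E(\hat\phi-\bar\phi)^2\le C\left(\frac{\sum_s \frac{N_s^2}{f_s}\gamma_s^2}{mT}+\frac1{hT}+h^2\right).$$ Moreover, if all shards are merged into one data set and the chain is SGLD, i.e. the gradient estimator is $\nabla\log p(\theta)+\frac Nm\sum_{y\in\mathbf x^{(m)}}\nabla\log p(y\mid\theta)$ with $m$ points drawn uniformly with replacement from the whole data set, if (d) holds for this chain, and if $\gamma\ge\gamma_1,\dots,\gamma_S$, then for some $C>0$ independent of $T$ and $h$, for all $h\in H$ and $T\ge1$, $$\mathbb E(\hat\phi-\bar\phi)^2\le C\left(\frac{N^2\gamma^2}{mT}+\frac1{hT}+h^2\right).$$ -/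

import Mathlib

open MeasureTheory ProbabilityTheory
open scoped Gradient

noncomputable section

namespace DSGLD

/-- The parameter space `ℝᵈ` with its Euclidean norm. -/
abbrev Param (d : ℕ) : Type := EuclideanSpace ℝ (Fin d)

/-- A Bayesian model together with a data set that is split into `S` shards: shard `s` holds the
`N s` data points `x s 0, …, x s (N s - 1)`. `prior θ` is the prior density `p(θ)` and `lik y θ` is
the likelihood `p(y | θ)` of a single datum `y`. -/
structure Model (d S : ℕ) (𝒳 : Type*) where
  prior : Param d → ℝ
  lik : 𝒳 → Param d → ℝ
  N : Fin S → ℕ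
  x : (s : Fin S) → Fin (N s) → 𝒳

variable {d S : ℕ} {𝒳 : Type*}

namespace Model

/-- The total number of data points. -/
def total (M : Model d S 𝒳) : ℕ := ∑ s, M.N s

/-- `p(θ) ∏ᵢ p(xᵢ | θ)`. -/
def unnormalized (M : Model d S 𝒳) (θ : Param d) : ℝ :=
  M.prior θ * ∏ s, ∏ i, M.lik (M.x s i) θ

/-- The posterior density `p(θ | x)`. -/
def posterior (M : Model d S 𝒳) (θ : Param d) : ℝ :=
  M.unnormalized θ / ∫ θ', M.unnormalized θ'

/-- The posterior expectation of `φ`. -/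
def posteriorMean (M : Model d S 𝒳) (φ : Param d → ℝ) : ℝ :=
  ∫ θ, φ θ * M.posterior θ

/-- The posterior is a well-defined density with a three times continuously differentiable
logarithm: the prior and the likelihood of every datum are positive and `C³`, the posterior is
proper, and no shard is empty. -/
structure IsRegular (M : Model d S 𝒳) : Prop where
  shard_nonempty : ∀ s, 0 < M.N s
  prior_pos : ∀ θ, 0 < M.prior θ
  lik_pos : ∀ s i θ, 0 < M.lik (M.x s i) θ
  prior_contDiff : ContDiff ℝ 3 M.prior
  lik_contDiff : ∀ s i, ContDiff ℝ 3 (M.lik (M.x s i))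
  proper : Integrable M.unnormalized

/-- The generator `ℒψ = ½ ∇ log p(θ | x) · ∇ψ + ½ Δψ` of the Langevin diffusion
`dθ = ½ ∇ log p(θ | x) dt + dW`. -/
def generator (M : Model d S 𝒳) (ψ : Param d → ℝ) (θ : Param d) : ℝ :=
  (1 / 2) * inner ℝ (∇ (fun θ' => Real.log (M.posterior θ')) θ) (∇ ψ θ)
    + (1 / 2) * Laplacian.laplacian ψ θ

/-- The gradient `∇ log p(y | θ)` of the log-likelihood of one datum. -/
def gradLogLik (M : Model d S 𝒳) (y : 𝒳) (θ : Param d) : Param d :=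
  ∇ (fun θ' => Real.log (M.lik y θ')) θ

/-- A choice of a shard together with `m` indices of data points in that shard. -/
abbrev ShardBatch (M : Model d S 𝒳) (m : ℕ) : Type := (s : Fin S) × (Fin m → Fin (M.N s))

/-- The probability of a shard and a mini-batch: the shard is drawn with probability `f s`, then the
`m` data points are drawn uniformly and with replacement from that shard. -/
def shardBatchProb (M : Model d S 𝒳) (f : Fin S → ℝ) (m : ℕ) (b : M.ShardBatch m) : ℝ :=
  f b.1 * (1 / (M.N b.1 : ℝ)) ^ m

/-- The DSGLD gradient estimator
`v_s(θ) = ∇ log p(θ) + N_s / (f_s m) ∑_{y in the mini-batch} ∇ log p(y | θ)`. -/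
def dsgldEstimator (M : Model d S 𝒳) (f : Fin S → ℝ) (m : ℕ) (b : M.ShardBatch m)
    (θ : Param d) : Param d :=
  ∇ (fun θ' => Real.log (M.prior θ')) θ
    + ((M.N b.1 : ℝ) / (f b.1 * m)) • ∑ j, M.gradLogLik (M.x b.1 (b.2 j)) θ

/-- `m` indices of data points in the merged data set. -/
abbrev MergedBatch (M : Model d S 𝒳) (m : ℕ) : Type := Fin m → (s : Fin S) × Fin (M.N s)

/-- The probability of a mini-batch drawn uniformly and with replacement from the merged data. -/
def mergedBatchProb (M : Model d S 𝒳) (m : ℕ) (_b : M.MergedBatch m) : ℝ :=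
  (1 / (M.total : ℝ)) ^ m

/-- The SGLD gradient estimator on the merged data,
`v(θ) = ∇ log p(θ) + N / m ∑_{y in the mini-batch} ∇ log p(y | θ)`. -/
def sgldEstimator (M : Model d S 𝒳) (m : ℕ) (b : M.MergedBatch m) (θ : Param d) : Param d :=
  ∇ (fun θ' => Real.log (M.prior θ')) θ
    + ((M.total : ℝ) / m) • ∑ j, M.gradLogLik (M.x (b j).1 (b j).2) θ

end Model

section Chain

variable {β : Type*} {Ω : Type*}

/-- The recursion `θ_{t+1} = θ_t + (h / 2) v_t(θ_t) + η_t` with constant step size `h`, where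
`v_t = v (B t)` is the gradient estimator of the random mini-batch `B t` and `η_t = √h Z_t`, so that
`η_t ∼ 𝒩(0, h I)` if `Z_t` is standard Gaussian. -/
def chain (v : β → Param d → Param d) (θ₀ : Ω → Param d) (B : ℕ → Ω → β)
    (Z : ℕ → Ω → Param d) (h : ℝ) : ℕ → Ω → Param d
  | 0, ω => θ₀ ω
  | t + 1, ω =>
      chain v θ₀ B Z h t ω + (h / 2) • v (B t ω) (chain v θ₀ B Z h t ω) + √h • Z t ω

/-- The sample average `T⁻¹ ∑_{t=1}^T φ(θ_t)`. -/
def sampleAverage (φ : Param d → ℝ) (θ : ℕ → Ω → Param d) (T : ℕ) (ω : Ω) : ℝ :=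
  (T : ℝ)⁻¹ * ∑ t ∈ Finset.Icc 1 T, φ (θ t ω)

/-- The randomness that drives the chain: an initial state, mini-batches `B t` with the
probabilities `w`, and standard Gaussian vectors `Z t`, all mutually independent. -/
structure IsDrivingNoise [MeasurableSpace β] [MeasurableSpace Ω] (P : Measure Ω) (w : β → ℝ)
    (θ₀ : Ω → Param d) (B : ℕ → Ω → β) (Z : ℕ → Ω → Param d) : Prop where
  measurable_init : Measurable θ₀
  measurable_batch : ∀ t, Measurable (B t)
  measurable_noise : ∀ t, Measurable (Z t)
  batch_law : ∀ t b, P.real (B t ⁻¹' {b}) = w b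
  noise_law : ∀ t, P.map (Z t) = stdGaussian (Param d)
  indep_batch_noise : ∀ t, IndepFun (B t) (Z t) P
  indep_time : iIndepFun (fun t ω => (B t ω, Z t ω)) P
  indep_init : IndepFun θ₀ (fun ω t => (B t ω, Z t ω)) P

/-- The moments of `Γ` of all orders `0 < ρ ≤ R` are bounded along the chain, uniformly in time and
in the step size `h ∈ H`. -/
def MomentsBounded [MeasurableSpace Ω] (P : Measure Ω) (Γ : Param d → ℝ) (R : ℝ) (H : Set ℝ)
    (θ : ℝ → ℕ → Ω → Param d) : Prop :=
  ∀ ρ : ℝ, 0 < ρ → ρ ≤ R → ∃ K : ℝ, ∀ h ∈ H, ∀ t : ℕ,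
    Integrable (fun ω => Γ (θ h t ω) ^ ρ) P ∧ ∫ ω, Γ (θ h t ω) ^ ρ ∂P ≤ K

end Chain

/-- The order up to which powers of the dominating function are controlled:
`2 max(p₀, p₁, p₂, p₃, r) + 6 q`. -/
def momentOrder (p : Fin 4 → ℝ) (r q : ℝ) : ℝ := 2 * max (⨆ k, p k) r + 6 * q

/-- The regularity conditions on the test function `φ` and the solution `ψ` of the Poisson equation
`ℒψ = φ - φ̄`: the derivatives of `ψ` up to order three, the second derivative of `φ`, and the
derivatives of the log-posterior of orders one to three are dominated by powers of `Γ`, and the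
powers of `Γ` are controlled along segments. -/
structure PoissonRegularity (M : Model d S 𝒳) (φ ψ Γ : Param d → ℝ) (p : Fin 4 → ℝ) (r q : ℝ) :
    Prop where
  test_contDiff : ContDiff ℝ 2 φ
  test_integrable : Integrable (fun θ => φ θ * M.posterior θ)
  sol_contDiff : ContDiff ℝ 3 ψ
  poisson : ∀ θ, M.generator ψ θ = φ θ - M.posteriorMean φ
  dom_measurable : Measurable Γ
  dom_nonneg : ∀ θ, 0 ≤ Γ θ
  p_pos : ∀ k, 0 < p k
  r_pos : 0 < r
  q_pos : 0 < q
  sol_growth : ∀ k : Fin 4, ∃ C : ℝ, ∀ θ, ‖iteratedFDeriv ℝ k ψ θ‖ ≤ C * Γ θ ^ p k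
  test_growth : ∃ C : ℝ, ∀ θ, ‖iteratedFDeriv ℝ 2 φ θ‖ ≤ C * (1 + Γ θ ^ r)
  logPosterior_growth : ∀ k : ℕ, 1 ≤ k → k ≤ 3 → ∃ C : ℝ, ∀ θ,
    ‖iteratedFDeriv ℝ k (fun θ' => Real.log (M.posterior θ')) θ‖ ≤ C * (1 + Γ θ ^ q)
  dom_segment : ∀ ρ : ℝ, 0 < ρ → ρ ≤ momentOrder p r q → ∃ C : ℝ, ∀ θ θ' : Param d,
    ∀ a ∈ Set.Ioo (0 : ℝ) 1, Γ (a • θ + (1 - a) • θ') ^ ρ ≤ C * (Γ θ ^ ρ + Γ θ' ^ ρ)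

end DSGLD

end

/-! Put $g=\phi-\bar\phi=\mathcal L\psi$. One step of the chain gives
$\psi(\theta_{t+1})-\psi(\theta_t)=h\,g(\theta_t)+M_t+R_t$, where $M_t$ is the increment centred
given $\theta_t$ and $R_t$ is the bias of the step. Summing over $t=1,\dots,T$ and dividing by $hT$
expresses $\hat\phi-\bar\phi$ through two boundary terms, the orthogonal $M_t$ with $\mathbb E
M_t^2=O(h)$, and the $R_t$ with $\mathbb E R_t^2=O(h^4)$. In mean square these contribute
$(hT)^{-2}$, $(hT)^{-1}$ and $h^2$ (`chain_mean_square`, `martingale_mean_square`,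
`exists_mean_square_average_le`). If $1/(hT)+h^2\ge 1$, a uniform second moment of $g$ is enough;
otherwise $h\le 1\le hT$.

Regularity: a Taylor expansion that gives $R_t=O(h^2)$ would use four derivatives of $\psi$, which
is only $C^3$. The Gaussian noise is treated as a heat flow instead. Stein's identity turns
$\frac{d}{ds}\mathbb E\psi(y+sZ)$ into $s\,\mathbb E\Delta\psi(y+sZ)$, and by the Poisson equation
$\Delta\psi=2(\phi-\bar\phi)-\nabla\log p(\cdot\mid x)\cdot\nabla\psi$ is $C^2$
(`abs_integral_add_smul_stdGaussian_sub_le`, `laplacian_contDiff`).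

Moments: $\Gamma$ is controlled only at states of the chain, while the expansion passes through the
drift point $\theta+\frac h2 v$. This point is the midpoint of the steps with noises $Z$ and $-Z$,
which have the same law, so the segment condition controls $\Gamma$ there (`drift_point_le`,
`integrable_sq_dominator`).

Gradient noise: the estimator is unbiased, so the first-order part of $R_t$ sees only the full
gradient. Its fluctuation adds order $h^2$ to the variance of $M_t$, less than the $h$ of the
Gaussian noise when $h\le1$. The bound thus holds with $1/(hT)+h^2$ alone, and the nonnegative
mini-batch term is added at the end. -/

noncomputable section

namespace DSGLD

/-! ### Standard Gaussian measure: density, Stein's identity, symmetry. -/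

section Gaussian

variable {E : Type*} [NormedAddCommGroup E] [InnerProductSpace ℝ E] [FiniteDimensional ℝ E]
  [MeasurableSpace E] [BorelSpace E]

theorem integrable_exp_neg_half_sq_norm :
    Integrable (fun z : E => Real.exp (-(1 / 2) * ‖z‖ ^ 2)) := by
  have h := GaussianFourier.integrable_cexp_neg_mul_sq_norm_add (V := E) (b := 1 / 2)
    (by norm_num) 0 0
  refine h.norm.congr (ae_of_all _ fun z => ?_)
  simp [Complex.norm_exp, ← Complex.ofReal_pow]

theorem integral_exp_neg_half_sq_norm_pos :
    0 < ∫ z : E, Real.exp (-(1 / 2) * ‖z‖ ^ 2) :=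
  integral_exp_pos integrable_exp_neg_half_sq_norm

variable (E) in
/-- The density of the standard Gaussian measure with respect to the volume. -/
def gaussianDensity (z : E) : ℝ :=
  (∫ z : E, Real.exp (-(1 / 2) * ‖z‖ ^ 2))⁻¹ * Real.exp (-(1 / 2) * ‖z‖ ^ 2)

theorem gaussianDensity_nonneg (z : E) : 0 ≤ gaussianDensity E z :=
  mul_nonneg (inv_nonneg.2 integral_exp_neg_half_sq_norm_pos.le) (Real.exp_nonneg _)

theorem continuous_gaussianDensity : Continuous (gaussianDensity E) := by
  unfold gaussianDensity; fun_prop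

theorem hasFDerivAt_gaussianDensity (z : E) :
    HasFDerivAt (gaussianDensity E) (-(gaussianDensity E z) • innerSL ℝ z) z := by
  have h1 : HasFDerivAt (fun z : E => -(1 / 2 : ℝ) * ‖z‖ ^ 2) (-(1 / 2 : ℝ) • (2 • innerSL ℝ z)) z :=
    (hasStrictFDerivAt_norm_sq z).hasFDerivAt.const_mul _
  have h2 := (h1.exp).const_mul (∫ z : E, Real.exp (-(1 / 2) * ‖z‖ ^ 2))⁻¹
  refine h2.congr_fderiv ?_
  ext w
  simp [gaussianDensity]
  ring

variable (E) in
-- Both measures have the same characteristic function. The density is what makes integration by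
-- parts against the volume possible.
theorem stdGaussian_eq_withDensity :
    stdGaussian E = volume.withDensity fun z => ENNReal.ofReal (gaussianDensity E z) := by
  have hintg : Integrable (gaussianDensity E) := integrable_exp_neg_half_sq_norm.const_mul _
  have : IsFiniteMeasure ((volume : Measure E).withDensity
      fun z => ENNReal.ofReal (gaussianDensity E z)) :=
    isFiniteMeasure_withDensity_ofReal hintg.2
  refine Measure.ext_of_charFun ?_
  ext t
  rw [charFun_stdGaussian, charFun_apply,
    integral_withDensity_eq_integral_toReal_smul (by
      exact (continuous_gaussianDensity.measurable).ennreal_ofReal) (by simp)]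
  have h0 := GaussianFourier.integral_cexp_neg_mul_sq_norm_add (V := E) (b := 1 / 2)
    (by norm_num) 0 0
  have ht := GaussianFourier.integral_cexp_neg_mul_sq_norm_add (V := E) (b := 1 / 2)
    (by norm_num) Complex.I t
  have hZ : ((∫ z : E, Real.exp (-(1 / 2) * ‖z‖ ^ 2) : ℝ) : ℂ)
      = (Real.pi / (1 / 2) : ℂ) ^ (Module.finrank ℝ E / 2 : ℂ) := by
    rw [← integral_complex_ofReal]
    simpa using h0
  have hne : ((∫ z : E, Real.exp (-(1 / 2) * ‖z‖ ^ 2) : ℝ) : ℂ) ≠ 0 := by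
    exact_mod_cast integral_exp_neg_half_sq_norm_pos.ne'
  rw [← hZ] at ht
  have : ∀ z : E, (ENNReal.ofReal (gaussianDensity E z)).toReal
      • Complex.exp (inner ℝ z t * Complex.I)
      = ((∫ z : E, Real.exp (-(1 / 2) * ‖z‖ ^ 2) : ℝ) : ℂ)⁻¹
        * Complex.exp (-(1 / 2) * ‖z‖ ^ 2 + Complex.I * inner ℝ t z) := by
    intro z
    rw [ENNReal.toReal_ofReal (gaussianDensity_nonneg z), gaussianDensity, Complex.exp_add,
      Complex.real_smul, real_inner_comm]
    push_cast
    ring_nf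
  simp_rw [this]
  rw [integral_const_mul, ht, inv_mul_cancel_left₀ hne]
  simp
  ring_nf

theorem integrable_stdGaussian_iff {f : E → ℝ} :
    Integrable f (stdGaussian E) ↔ Integrable fun z => gaussianDensity E z * f z := by
  rw [stdGaussian_eq_withDensity E, integrable_withDensity_iff_integrable_smul'
    (continuous_gaussianDensity.measurable).ennreal_ofReal (by simp)]
  simp [ENNReal.toReal_ofReal (gaussianDensity_nonneg _)]

theorem integral_stdGaussian_eq (f : E → ℝ) :
    ∫ z, f z ∂(stdGaussian E) = ∫ z, gaussianDensity E z * f z := by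
  rw [stdGaussian_eq_withDensity E, integral_withDensity_eq_integral_toReal_smul
    (continuous_gaussianDensity.measurable).ennreal_ofReal (by simp)]
  simp [ENNReal.toReal_ofReal (gaussianDensity_nonneg _)]

/-- **Stein's identity** for the standard Gaussian measure. -/
theorem integral_mul_inner_stdGaussian {f : E → ℝ} (hf : Differentiable ℝ f) (e : E)
    (hintg : Integrable f (stdGaussian E))
    (hintg_inner : Integrable (fun z => f z * inner ℝ e z) (stdGaussian E))
    (hintg_deriv : Integrable (fun z => fderiv ℝ f z e) (stdGaussian E)) :
    ∫ z, f z * inner ℝ e z ∂(stdGaussian E) = ∫ z, fderiv ℝ f z e ∂(stdGaussian E) := by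
  rw [integrable_stdGaussian_iff] at *
  rw [integral_stdGaussian_eq, integral_stdGaussian_eq]
  -- The density $\rho$ satisfies $\partial_e\rho=-\langle e,z\rangle\rho$, so the identity is
  -- integration by parts for $\rho f$.
  have hd : ∀ z : E, fderiv ℝ (gaussianDensity E) z e = -(gaussianDensity E z * inner ℝ e z) := by
    intro z
    rw [(hasFDerivAt_gaussianDensity z).fderiv]
    simp [real_inner_comm]
  have := integral_mul_fderiv_eq_neg_fderiv_mul_of_integrable (μ := (volume : Measure E))
    (f := gaussianDensity E) (g := f) (v := e)
    (by simp_rw [hd]; refine hintg_inner.neg.congr (ae_of_all _ fun z => ?_); simp; ring)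
    hintg_deriv hintg (fun z _ => (hasFDerivAt_gaussianDensity z).differentiableAt)
    (fun z _ => hf z)
  rw [this, ← integral_neg]
  simp_rw [hd]
  congr 1 with z
  ring

theorem integrable_norm_rpow_stdGaussian {k : ℝ} (hk : 0 < k) :
    Integrable (fun z : E => ‖z‖ ^ k) (stdGaussian E) := by
  have := (IsGaussian.memLp_id (stdGaussian E) (ENNReal.ofReal k) (by simp)).integrable_norm_rpow
    (by simpa using hk) (by simp)
  simpa [ENNReal.toReal_ofReal hk.le] using this

theorem map_neg_stdGaussian : (stdGaussian E).map (fun z => -z) = stdGaussian E :=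
  stdGaussian_map (LinearIsometryEquiv.neg ℝ (E := E))

end Gaussian

/-! ### Taylor bounds with derivatives controlled only on the segment. -/

section Taylor

variable {E : Type*} [NormedAddCommGroup E] [NormedSpace ℝ E]
  {F : Type*} [NormedAddCommGroup F] [NormedSpace ℝ F]

theorem norm_image_add_sub_le {f : E → F} (hf : Differentiable ℝ f) {x u : E} {G : ℝ}
    (hG : ∀ c ∈ Set.Icc (0 : ℝ) 1, ‖fderiv ℝ f (x + c • u)‖ ≤ G) :
    ‖f (x + u) - f x‖ ≤ G * ‖u‖ := by
  have := (convex_segment (𝕜 := ℝ) x (x + u)).norm_image_sub_le_of_norm_fderiv_le (f := f) (C := G)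
    (fun w _ => hf w) (fun w hw => by
      rw [segment_eq_image'] at hw
      obtain ⟨c, hc, rfl⟩ := hw
      simpa using hG c hc) (left_mem_segment ℝ _ _) (right_mem_segment ℝ _ _)
  simpa using this

/-- The mean value inequality is applied twice, to `fderiv ℝ f` and then to `f` minus its linear
part; the lost factor $1/2$ is immaterial. -/
theorem norm_image_add_sub_sub_fderiv_le {f : E → F} (hf : ContDiff ℝ 2 f) {x u : E} {G : ℝ}
    (hG : ∀ c ∈ Set.Icc (0 : ℝ) 1, ‖fderiv ℝ (fderiv ℝ f) (x + c • u)‖ ≤ G) :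
    ‖f (x + u) - f x - fderiv ℝ f x u‖ ≤ G * ‖u‖ ^ 2 := by
  have hd : Differentiable ℝ f := hf.differentiable (by norm_num)
  have hd' : Differentiable ℝ (fderiv ℝ f) :=
    (hf.fderiv_right (m := 1) (by norm_num)).differentiable (by norm_num)
  have hG0 : 0 ≤ G := 
    le_trans (norm_nonneg (fderiv ℝ (fderiv ℝ f) (x + (0 : ℝ) • u))) (hG 0 (by simp))
  have h1 : ∀ c ∈ Set.Icc (0 : ℝ) 1, ‖fderiv ℝ f (x + c • u) - fderiv ℝ f x‖ ≤ G * ‖u‖ := by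
    intro c hc
    refine (norm_image_add_sub_le hd' (x := x) (u := c • u) (G := G) fun c' hc' => ?_).trans ?_
    · rw [smul_smul]
      exact hG _ ⟨mul_nonneg hc'.1 hc.1, mul_le_one₀ hc'.2 hc.1 hc.2⟩
    · rw [norm_smul, Real.norm_of_nonneg hc.1]
      exact mul_le_mul_of_nonneg_left (mul_le_of_le_one_left (norm_nonneg _) hc.2) hG0
  have h2 := norm_image_add_sub_le (f := fun w => f w - fderiv ℝ f x w) (x := x) (u := u)
    (G := G * ‖u‖) (hd.sub (fderiv ℝ f x).differentiable) (fun c hc => by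
      rw [fderiv_fun_sub (hd _) (fderiv ℝ f x).differentiableAt, ContinuousLinearMap.fderiv]
      exact h1 c hc)
  calc ‖f (x + u) - f x - fderiv ℝ f x u‖
      = ‖f (x + u) - fderiv ℝ f x (x + u) - (f x - fderiv ℝ f x x)‖ := by
        rw [map_add]; congr 1; abel
    _ ≤ G * ‖u‖ ^ 2 := h2.trans_eq (by ring)

end Taylor

/-! ### Heat-flow expansion of a Gaussian average. -/

section Heat

variable {E : Type*} [NormedAddCommGroup E] [InnerProductSpace ℝ E] [FiniteDimensional ℝ E]

theorem laplacian_eq_sum_fderiv_fderiv {ι : Type*} [Fintype ι] (b : OrthonormalBasis ι ℝ E)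
    (ψ : E → ℝ) (u : E) :
    Laplacian.laplacian ψ u = ∑ i, fderiv ℝ (fderiv ℝ ψ) u (b i) (b i) := by
  rw [congrFun (InnerProductSpace.laplacian_eq_iteratedFDeriv_orthonormalBasis ψ b) u]
  simp [iteratedFDeriv_two_apply]

variable [MeasurableSpace E] [BorelSpace E]

/-- The Gaussian integration by parts that turns a time derivative of the heat flow into a
Laplacian. -/
theorem integral_fderiv_add_smul_stdGaussian {ψ : E → ℝ} (hψ : ContDiff ℝ 2 ψ) (y : E) (s : ℝ)
    {G : E → ℝ} (hG : Integrable G (stdGaussian E))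
    (hG' : Integrable (fun z => ‖z‖ * G z) (stdGaussian E))
    (h1 : ∀ z, ‖fderiv ℝ ψ (y + s • z)‖ ≤ G z)
    (h2 : ∀ z, ‖fderiv ℝ (fderiv ℝ ψ) (y + s • z)‖ ≤ G z) :
    ∫ z, fderiv ℝ ψ (y + s • z) z ∂(stdGaussian E)
      = s * ∫ z, Laplacian.laplacian ψ (y + s • z) ∂(stdGaussian E) := by
  set b := stdOrthonormalBasis ℝ E
  have hd : ContDiff ℝ 1 (fderiv ℝ ψ) := hψ.fderiv_right (by norm_num)
  have hdc : Continuous (fderiv ℝ ψ) := hd.continuous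
  have hddc : Continuous (fderiv ℝ (fderiv ℝ ψ)) := hd.continuous_fderiv (by norm_num)
  have hbd : ∀ i z, ‖fderiv ℝ ψ (y + s • z) (b i)‖ ≤ G z := fun i z =>
    ((fderiv ℝ ψ (y + s • z)).le_opNorm _).trans (by simpa using h1 z)
  have hf : ∀ i z, HasFDerivAt (fun z => fderiv ℝ ψ (y + s • z) (b i))
      (s • (fderiv ℝ (fderiv ℝ ψ) (y + s • z)).flip (b i)) z := by
    intro i z
    have ha : HasFDerivAt (fun z : E => y + s • z) (s • ContinuousLinearMap.id ℝ E) z :=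
      ((hasFDerivAt_id z).const_smul s).const_add y
    have hb := ((hd.differentiable (by norm_num) (y + s • z)).hasFDerivAt.comp z ha).clm_apply
      (hasFDerivAt_const (b i) z)
    refine hb.congr_fderiv ?_
    ext w
    simp
  have hintg : ∀ i, Integrable (fun z => fderiv ℝ ψ (y + s • z) (b i)) (stdGaussian E) := fun i =>
    hG.mono' (by fun_prop) (ae_of_all _ (hbd i))
  have hintg' : ∀ i, Integrable (fun z => fderiv ℝ ψ (y + s • z) (b i) * inner ℝ (b i) z)
      (stdGaussian E) := fun i => by
    refine hG'.mono' (by fun_prop) (ae_of_all _ fun z => ?_)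
    rw [norm_mul, mul_comm]
    exact mul_le_mul ((norm_inner_le_norm _ _).trans (by simp)) (hbd i z) (norm_nonneg _)
      (norm_nonneg _)
  have hintg2 : ∀ i, Integrable (fun z => fderiv ℝ (fderiv ℝ ψ) (y + s • z) (b i) (b i))
      (stdGaussian E) := fun i => by
    refine hG.mono' (by fun_prop) (ae_of_all _ fun z => ?_)
    refine (ContinuousLinearMap.le_opNorm₂ _ _ _).trans ?_
    simpa using h2 z
  -- Stein's identity in the direction `b i`; the chain rule supplies the factor `s`, and the sum
  -- over `i` is the trace that makes the Laplacian.
  have key : ∀ i, ∫ z, fderiv ℝ ψ (y + s • z) (b i) * inner ℝ (b i) z ∂(stdGaussian E)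
      = s * ∫ z, fderiv ℝ (fderiv ℝ ψ) (y + s • z) (b i) (b i) ∂(stdGaussian E) := by
    intro i
    rw [← integral_const_mul, integral_mul_inner_stdGaussian (fun z => (hf i z).differentiableAt)
      (b i) (hintg i) (hintg' i)]
    · simp_rw [(hf i _).fderiv]; simp
    · simp_rw [(hf i _).fderiv]; simpa using (hintg2 i).const_mul s
  have hl : ∀ z, fderiv ℝ ψ (y + s • z) z
      = ∑ i, fderiv ℝ ψ (y + s • z) (b i) * inner ℝ (b i) z := by
    intro z
    have h := congrArg (fderiv ℝ ψ (y + s • z)) (b.sum_repr' z)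
    rw [map_sum] at h
    rw [← h]
    exact Finset.sum_congr rfl fun i _ => by rw [map_smul, smul_eq_mul, mul_comm]
  simp_rw [hl, laplacian_eq_sum_fderiv_fderiv b]
  rw [integral_finsetSum _ fun i _ => hintg' i, integral_finsetSum _ fun i _ => hintg2 i,
    Finset.mul_sum]
  exact Finset.sum_congr rfl fun i _ => key i

/-- A second order expansion of the heat flow of `ψ`, which needs only two derivatives of `ψ` and
two derivatives of its Laplacian. -/
theorem abs_integral_add_smul_stdGaussian_sub_le {ψ F : E → ℝ} (hψ : ContDiff ℝ 2 ψ)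
    (hF : ContDiff ℝ 2 F) (hψF : ∀ u, Laplacian.laplacian ψ u = F u) (y : E) {σ : ℝ} (hσ : 0 ≤ σ)
    {G : E → ℝ} (hG : Integrable G (stdGaussian E))
    (hG' : Integrable (fun z => ‖z‖ ^ 2 * G z) (stdGaussian E))
    (h1 : ∀ z, ∀ s ∈ Set.Icc 0 σ, ‖fderiv ℝ ψ (y + s • z)‖ ≤ G z)
    (h2 : ∀ z, ∀ s ∈ Set.Icc 0 σ, ‖fderiv ℝ (fderiv ℝ ψ) (y + s • z)‖ ≤ G z)
    (h3 : ∀ z, ∀ s ∈ Set.Icc 0 σ, ‖fderiv ℝ (fderiv ℝ F) (y + s • z)‖ ≤ G z) :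
    Integrable (fun z => ψ (y + σ • z)) (stdGaussian E) ∧
    |∫ z, ψ (y + σ • z) ∂(stdGaussian E) - ψ y - σ ^ 2 / 2 * F y|
      ≤ σ ^ 4 * ∫ z, ‖z‖ ^ 2 * G z ∂(stdGaussian E) := by
  have hd : Differentiable ℝ ψ := hψ.differentiable (by norm_num)
  have hd' : ContDiff ℝ 1 (fderiv ℝ ψ) := hψ.fderiv_right (by norm_num)
  have hdc : Continuous (fderiv ℝ ψ) := hd'.continuous
  have hψc : Continuous ψ := hψ.continuous
  have hFc : Continuous F := hF.continuous
  have hG0 : ∀ z, 0 ≤ G z := fun z => (norm_nonneg _).trans (h1 z 0 ⟨le_rfl, hσ⟩)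
  have hG1 : Integrable (fun z => ‖z‖ * G z) (stdGaussian E) := by
    refine (hG.add hG').mono' (continuous_norm.aestronglyMeasurable.mul hG.1)
      (ae_of_all _ fun z => ?_)
    rw [Real.norm_of_nonneg (mul_nonneg (norm_nonneg _) (hG0 z))]
    simp only [Pi.add_apply]
    nlinarith [hG0 z, mul_nonneg (hG0 z) (sq_nonneg (‖z‖ - 1)),
      mul_nonneg (hG0 z) (sq_nonneg (‖z‖))]
  have hψint : Integrable (fun z => ψ (y + σ • z)) (stdGaussian E) := by
    refine ((integrable_const |ψ y|).add (hG1.const_mul σ)).mono' (by fun_prop)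
      (ae_of_all _ fun z => ?_)
    have := norm_image_add_sub_le hd (x := y) (u := σ • z) (G := G z) (fun c hc => by
      rw [smul_smul]
      exact h1 z _ ⟨mul_nonneg hc.1 hσ, mul_le_of_le_one_left hσ hc.2⟩)
    rw [norm_smul, Real.norm_of_nonneg hσ] at this
    simp only [Pi.add_apply, Real.norm_eq_abs] at *
    have h4 := abs_sub_abs_le_abs_sub (ψ (y + σ • z)) (ψ y)
    linarith
  refine ⟨hψint, ?_⟩
  -- The linear term of `F` is subtracted because its Gaussian mean vanishes. This leaves a mean
  -- deviation of order $s^2$ instead of $s$.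
  have hFbd : ∀ s ∈ Set.Icc 0 σ, ∀ z,
      ‖F (y + s • z) - F y - s * fderiv ℝ F y z‖ ≤ s ^ 2 * (‖z‖ ^ 2 * G z) := by
    intro s hs z
    have := norm_image_add_sub_sub_fderiv_le hF (x := y) (u := s • z) (G := G z) (fun c hc => by
      rw [smul_smul]
      exact h3 z _ ⟨mul_nonneg hc.1 hs.1, (mul_le_of_le_one_left hs.1 hc.2).trans hs.2⟩)
    rw [norm_smul, Real.norm_of_nonneg hs.1, map_smul, smul_eq_mul] at this
    exact this.trans_eq (by ring)
  have hlin : Integrable (fun z => fderiv ℝ F y z) (stdGaussian E) :=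
    (fderiv ℝ F y).integrable_comp IsGaussian.integrable_id
  have hrem : ∀ s ∈ Set.Icc 0 σ,
      Integrable (fun z => F (y + s • z) - F y - s * fderiv ℝ F y z) (stdGaussian E) :=
    fun s hs => (hG'.const_mul (s ^ 2)).mono' (by fun_prop) (ae_of_all _ (hFbd s hs))
  have hFint : ∀ s ∈ Set.Icc 0 σ, Integrable (fun z => F (y + s • z)) (stdGaussian E) := by
    intro s hs
    refine (((hrem s hs).add (integrable_const (F y))).add (hlin.const_mul s)).congr
      (ae_of_all _ fun z => ?_)
    simp only [Pi.add_apply]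
    ring
  have hmean : ∀ s ∈ Set.Icc 0 σ, |∫ z, F (y + s • z) ∂(stdGaussian E) - F y|
      ≤ s ^ 2 * ∫ z, ‖z‖ ^ 2 * G z ∂(stdGaussian E) := by
    intro s hs
    have he : ∫ z, (F (y + s • z) - F y - s * fderiv ℝ F y z) ∂(stdGaussian E)
        = ∫ z, F (y + s • z) ∂(stdGaussian E) - F y := by
      have hsub : Integrable (fun z => F (y + s • z) - F y) (stdGaussian E) :=
        (hFint s hs).sub (integrable_const _)
      rw [integral_sub hsub (hlin.const_mul s),
        integral_sub (hFint s hs) (integrable_const _), integral_const_mul,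
        integral_strongDual_stdGaussian]
      simp
    rw [← he, ← integral_const_mul]
    exact norm_integral_le_of_norm_le (hG'.const_mul _) (ae_of_all _ (hFbd s hs))
  have hftc : ∀ z, ψ (y + σ • z) - ψ y = ∫ s in (0 : ℝ)..σ, fderiv ℝ ψ (y + s • z) z := by
    intro z
    have hder : ∀ s : ℝ, HasDerivAt (fun s : ℝ => ψ (y + s • z)) (fderiv ℝ ψ (y + s • z) z) s := by
      intro s
      have ha : HasDerivAt (fun s : ℝ => y + s • z) z s := by
        simpa using ((hasDerivAt_id s).smul_const z).const_add y
      exact (hd (y + s • z)).hasFDerivAt.comp_hasDerivAt s ha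
    rw [intervalIntegral.integral_eq_sub_of_hasDerivAt (fun s _ => hder s)
      (Continuous.intervalIntegrable (by fun_prop) _ _)]
    simp
  have hswap : ∫ z, ψ (y + σ • z) ∂(stdGaussian E) - ψ y
      = ∫ s in (0 : ℝ)..σ, ∫ z, fderiv ℝ ψ (y + s • z) z ∂(stdGaussian E) := by
    have he : ∫ z, (ψ (y + σ • z) - ψ y) ∂(stdGaussian E)
        = ∫ z, ψ (y + σ • z) ∂(stdGaussian E) - ψ y := by
      rw [integral_sub hψint (integrable_const _)]; simp
    rw [← he]
    simp_rw [hftc, intervalIntegral.integral_of_le hσ]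
    refine integral_integral_swap ?_
    refine (hG1.comp_fst (volume.restrict (Set.Ioc 0 σ))).mono'
      (Continuous.aestronglyMeasurable (by unfold Function.uncurry; fun_prop)) ?_
    filter_upwards [Measure.quasiMeasurePreserving_snd.ae
      (ae_restrict_mem (μ := volume) (measurableSet_Ioc (a := (0 : ℝ)) (b := σ)))] with p hp
    refine (ContinuousLinearMap.le_opNorm _ _).trans ?_
    rw [mul_comm]
    exact mul_le_mul_of_nonneg_left (h1 _ _ ⟨hp.1.le, hp.2⟩) (norm_nonneg _)
  have hstein : ∀ s ∈ Set.uIcc 0 σ, ∫ z, fderiv ℝ ψ (y + s • z) z ∂(stdGaussian E)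
      = s * ∫ z, F (y + s • z) ∂(stdGaussian E) := by
    intro s hs
    rw [Set.uIcc_of_le hσ] at hs
    simp_rw [← hψF]
    exact integral_fderiv_add_smul_stdGaussian hψ y s hG hG1 (fun z => h1 z s hs)
      (fun z => h2 z s hs)
  rw [hswap, intervalIntegral.integral_congr hstein]
  set K := ∫ z, ‖z‖ ^ 2 * G z ∂(stdGaussian E) with hK
  have hK0 : 0 ≤ K := integral_nonneg fun z => mul_nonneg (sq_nonneg _) (hG0 z)
  have hmeas : StronglyMeasurable fun s : ℝ => ∫ z, F (y + s • z) ∂(stdGaussian E) :=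
    StronglyMeasurable.integral_prod_right' (ν := stdGaussian E)
      (f := fun p : ℝ × E => F (y + p.1 • p.2)) (Continuous.stronglyMeasurable (by fun_prop))
  have hii : IntervalIntegrable (fun s => s * ∫ z, F (y + s • z) ∂(stdGaussian E)) volume 0 σ := by
    refine IntervalIntegrable.mono_fun' (g := fun _ => σ * (|F y| + σ ^ 2 * K))
      intervalIntegrable_const (by fun_prop) ?_
    refine (ae_restrict_mem measurableSet_uIoc).mono fun s hs => ?_
    rw [Set.uIoc_of_le hσ] at hs
    have hs' : s ∈ Set.Icc 0 σ := ⟨hs.1.le, hs.2⟩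
    have h4 := hmean s hs'
    have h5 := abs_sub_abs_le_abs_sub (∫ z, F (y + s • z) ∂(stdGaussian E)) (F y)
    have h6 : s ^ 2 * K ≤ σ ^ 2 * K :=
      mul_le_mul_of_nonneg_right (pow_le_pow_left₀ hs'.1 hs'.2 2) hK0
    beta_reduce
    rw [norm_mul, Real.norm_of_nonneg hs'.1]
    exact mul_le_mul hs'.2 (by rw [Real.norm_eq_abs]; linarith) (norm_nonneg _) hσ
  have hconst : σ ^ 2 / 2 * F y = ∫ s in (0 : ℝ)..σ, s * F y := by
    rw [intervalIntegral.integral_mul_const, integral_id]; ring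
  rw [hconst, ← intervalIntegral.integral_sub hii
    (Continuous.intervalIntegrable (by fun_prop) _ _), ← Real.norm_eq_abs]
  -- The integrand $s\,|\mathbb E F(y+sZ)-F(y)|$ is at most $s\cdot s^2K$, and the interval has
  -- length $\sigma$, hence $\sigma^4$.
  refine (intervalIntegral.norm_integral_le_of_norm_le_const (C := σ ^ 3 * K)
    fun s hs => ?_).trans_eq ?_
  · rw [Set.uIoc_of_le hσ] at hs
    have hs' : s ∈ Set.Icc 0 σ := ⟨hs.1.le, hs.2⟩
    rw [← mul_sub, norm_mul, Real.norm_of_nonneg hs'.1, Real.norm_eq_abs]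
    calc s * |∫ z, F (y + s • z) ∂(stdGaussian E) - F y| ≤ s * (s ^ 2 * K) :=
          mul_le_mul_of_nonneg_left (hmean s hs') hs'.1
      _ = s ^ 3 * K := by ring
      _ ≤ σ ^ 3 * K := mul_le_mul_of_nonneg_right (pow_le_pow_left₀ hs'.1 hs'.2 3) hK0
  · rw [sub_zero, abs_of_nonneg hσ]; ring

end Heat

/-! ### Pointwise estimates for one step of the chain. -/

section OneStep

variable {d : ℕ} {β : Type*}

/-- A function `W ≥ 1` that is controlled along segments and whose powers dominate `ψ`, its
Laplacian `F`, their derivatives up to order two, and the drifts `v b`. -/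
structure GrowthBounds (W ψ F : Param d → ℝ) (v : β → Param d → Param d) (A κ a q : ℝ) :
    Prop where
  one_le_A : 1 ≤ A
  one_le_κ : 1 ≤ κ
  a_pos : 0 < a
  q_pos : 0 < q
  one_le : ∀ θ, 1 ≤ W θ
  measurable : Measurable W
  segment : ∀ θ u : Param d, ∀ c ∈ Set.Icc (0 : ℝ) 1, W (θ + c • u) ≤ κ * max (W θ) (W (θ + u))
  sol_contDiff : ContDiff ℝ 2 ψ
  lap_contDiff : ContDiff ℝ 2 F
  lap_eq : ∀ θ, Laplacian.laplacian ψ θ = F θ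
  sol_le : ∀ θ, |ψ θ| ≤ A * W θ ^ a
  fderiv_sol_le : ∀ θ, ‖fderiv ℝ ψ θ‖ ≤ A * W θ ^ a
  fderiv_fderiv_sol_le : ∀ θ, ‖fderiv ℝ (fderiv ℝ ψ) θ‖ ≤ A * W θ ^ a
  lap_le : ∀ θ, |F θ| ≤ A * W θ ^ a
  fderiv_lap_le : ∀ θ, ‖fderiv ℝ F θ‖ ≤ A * W θ ^ a
  fderiv_fderiv_lap_le : ∀ θ, ‖fderiv ℝ (fderiv ℝ F) θ‖ ≤ A * W θ ^ a
  drift_continuous : ∀ b, Continuous (v b)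
  drift_le : ∀ b θ, ‖v b θ‖ ≤ A * W θ ^ q

/-- One step of the chain from `θ`, driven by a batch and a Gaussian vector. -/
def step (v : β → Param d → Param d) (h : ℝ) (θ : Param d) (ξ : β × Param d) : Param d :=
  θ + (h / 2) • v ξ.1 θ + √h • ξ.2

/-- The largest value of `W` at `θ` and at the two ends of a step with the noise `± ξ.2`. -/
def envelope (W : Param d → ℝ) (v : β → Param d → Param d) (h : ℝ) (θ : Param d)
    (ξ : β × Param d) : ℝ :=
  max (W θ) (max (W (step v h θ ξ)) (W (step v h θ (ξ.1, -ξ.2))))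

/-- The quantity that dominates the error terms of one step. -/
def dominator (W : Param d → ℝ) (v : β → Param d → Param d) (a q h : ℝ) (θ : Param d)
    (ξ : β × Param d) : ℝ :=
  ‖ξ.2‖ ^ ((a + 2 * q) / q) + envelope W v h θ ξ ^ (a + 2 * q)

/-- Young's inequality with exponents $(a+2q)/(2q)$ and $(a+2q)/a$. The envelope depends on the
noise, so the two factors cannot be integrated separately; after splitting, the first is a Gaussian
moment and the second involves `W` to the power $a+2q$ only. -/
theorem sq_mul_rpow_le {x y a q : ℝ} (hx : 0 ≤ x) (hy : 0 ≤ y) (ha : 0 < a) (hq : 0 < q) :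
    x ^ 2 * y ^ a ≤ x ^ ((a + 2 * q) / q) + y ^ (a + 2 * q) := by
  have hc : ((a + 2 * q) / (2 * q)).HolderConjugate ((a + 2 * q) / a) := by
    rw [Real.holderConjugate_iff]
    constructor
    · rw [lt_div_iff₀ (by positivity)]; linarith
    · field_simp; ring
  have h := Real.young_inequality_of_nonneg (sq_nonneg x) (Real.rpow_nonneg hy a) hc
  have e1 : (x ^ 2) ^ ((a + 2 * q) / (2 * q)) = x ^ ((a + 2 * q) / q) := by
    rw [← Real.rpow_natCast_mul hx]; congr 1; push_cast; field_simp
  have e2 : (y ^ a) ^ ((a + 2 * q) / a) = y ^ (a + 2 * q) := by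
    rw [← Real.rpow_mul hy]; congr 1; field_simp
  rw [e1, e2] at h
  refine h.trans (add_le_add (div_le_self (Real.rpow_nonneg hx _) hc.lt.le)
    (div_le_self (Real.rpow_nonneg hy _) hc.symm.lt.le))

namespace GrowthBounds

variable {W ψ F : Param d → ℝ} {v : β → Param d → Param d} {A κ a q : ℝ}

section Pointwise

variable (hW : GrowthBounds W ψ F v A κ a q) (h : ℝ) (θ : Param d) (b : β) (z : Param d)

include hW

theorem one_le_envelope (ξ : β × Param d) : 1 ≤ envelope W v h θ ξ :=
  (hW.one_le θ).trans (le_max_left _ _)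

theorem dominator_nonneg (ξ : β × Param d) : 0 ≤ dominator W v a q h θ ξ :=
  add_nonneg (Real.rpow_nonneg (norm_nonneg _) _)
    (Real.rpow_nonneg (zero_le_one.trans (hW.one_le_envelope h θ ξ)) _)

theorem rpow_envelope_le_dominator (ξ : β × Param d) {c : ℝ} (hc : c ≤ a + 2 * q) :
    envelope W v h θ ξ ^ c ≤ dominator W v a q h θ ξ :=
  (Real.rpow_le_rpow_of_exponent_le (hW.one_le_envelope h θ ξ) hc).trans
    (le_add_of_nonneg_left (Real.rpow_nonneg (norm_nonneg _) _))

theorem sq_mul_rpow_envelope_le_dominator (ξ : β × Param d) :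
    ‖ξ.2‖ ^ 2 * envelope W v h θ ξ ^ a ≤ dominator W v a q h θ ξ :=
  sq_mul_rpow_le (norm_nonneg _) (zero_le_one.trans (hW.one_le_envelope h θ ξ)) hW.a_pos hW.q_pos

/-- The drift point is the midpoint of the endpoints for `z` and `-z`. This is why the envelope
contains the reflected step: no moment is assumed at the drift point itself. -/
theorem drift_point_le : W (θ + (h / 2) • v b θ) ≤ κ * envelope W v h θ (b, z) := by
  have := hW.segment (step v h θ (b, z)) (-(2 : ℝ) • √h • z) (1 / 2) (by norm_num)
  have e1 : step v h θ (b, z) + (1 / 2 : ℝ) • (-(2 : ℝ) • √h • z) = θ + (h / 2) • v b θ := by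
    simp only [step]; module
  have e2 : step v h θ (b, z) + -(2 : ℝ) • √h • z = step v h θ (b, -z) := by
    simp only [step]; module
  rw [e1, e2] at this
  exact this.trans (mul_le_mul_of_nonneg_left (le_max_right _ _) (by linarith [hW.one_le_κ]))

/-- One factor `κ` comes from the segment at hand, the other from `drift_point_le`. -/
theorem le_of_le_max_drift_point {w x : ℝ}
    (hx : x ≤ envelope W v h θ (b, z))
    (hw : w ≤ κ * max x (W (θ + (h / 2) • v b θ))) :
    w ≤ κ ^ 2 * envelope W v h θ (b, z) := by
  have hκ := hW.one_le_κ
  have hY := hW.one_le_envelope h θ (b, z)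
  refine hw.trans ?_
  rw [pow_two, mul_assoc]
  refine mul_le_mul_of_nonneg_left (max_le (hx.trans ?_) (hW.drift_point_le h θ b z)) (by linarith)
  exact le_mul_of_one_le_left (by linarith) hκ

theorem drift_segment_le {c : ℝ} (hc : c ∈ Set.Icc (0 : ℝ) 1) :
    W (θ + c • (h / 2) • v b θ) ≤ κ ^ 2 * envelope W v h θ (b, z) :=
  hW.le_of_le_max_drift_point h θ b z (le_max_left _ _) (hW.segment θ _ c hc)

theorem noise_segment_le {s : ℝ} (hs : s ∈ Set.Icc 0 √h) :
    W (θ + (h / 2) • v b θ + s • z) ≤ κ ^ 2 * envelope W v h θ (b, z) := by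
  refine hW.le_of_le_max_drift_point h θ b z (x := W (step v h θ (b, z)))
    ((le_max_left _ _).trans (le_max_right _ _)) ?_
  -- For `√h = 0` the segment degenerates to the drift point and `s / √h` is not a usable parameter.
  rcases (hs.1.trans hs.2).eq_or_lt with h0 | h0
  · have : s = 0 := le_antisymm (hs.2.trans h0.symm.le) hs.1
    subst this
    refine le_trans ?_ (mul_le_mul_of_nonneg_left (le_max_right _ _) (by linarith [hW.one_le_κ]))
    simpa using le_mul_of_one_le_left (by linarith [hW.one_le (θ + (h / 2) • v b θ)]) hW.one_le_κ
  · have := hW.segment (θ + (h / 2) • v b θ) (√h • z) (s / √h)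
      ⟨div_nonneg hs.1 h0.le, (div_le_one h0).2 hs.2⟩
    rw [smul_smul, div_mul_cancel₀ _ h0.ne', max_comm] at this
    exact this

theorem step_segment_le {c : ℝ} (hc : c ∈ Set.Icc (0 : ℝ) 1) :
    W (θ + c • ((h / 2) • v b θ + √h • z)) ≤ κ ^ 2 * envelope W v h θ (b, z) := by
  have hκ := hW.one_le_κ
  have hY := hW.one_le_envelope h θ (b, z)
  have h1 := hW.segment θ ((h / 2) • v b θ + √h • z) c hc
  rw [← add_assoc] at h1
  calc _ ≤ κ * envelope W v h θ (b, z) := h1.trans (mul_le_mul_of_nonneg_left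
          (max_le (le_max_left _ _) ((le_max_left _ _).trans (le_max_right _ _))) (by linarith))
    _ ≤ _ := mul_le_mul_of_nonneg_right (by nlinarith) (by linarith)

theorem bound_of_le {x w : ℝ} (h0 : 0 ≤ w) (hx : x ≤ A * w ^ a) {Y : ℝ} (hY : 0 ≤ Y)
    (hw : w ≤ κ ^ 2 * Y) : x ≤ A * (κ ^ 2) ^ a * Y ^ a := by
  refine hx.trans ?_
  rw [mul_assoc, ← Real.mul_rpow (sq_nonneg κ) hY]
  exact mul_le_mul_of_nonneg_left (Real.rpow_le_rpow h0 hw hW.a_pos.le) (by linarith [hW.one_le_A])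

theorem one_le_rpow_κ : 1 ≤ (κ ^ 2) ^ a :=
  Real.one_le_rpow (one_le_pow₀ hW.one_le_κ) hW.a_pos.le

theorem drift_le_envelope : ‖v b θ‖ ≤ A * envelope W v h θ (b, z) ^ q :=
  (hW.drift_le b θ).trans (mul_le_mul_of_nonneg_left (Real.rpow_le_rpow
    (by linarith [hW.one_le θ]) (le_max_left _ _) hW.q_pos.le) (by linarith [hW.one_le_A]))

variable {h} (h0 : 0 < h)

include h0

/-- The drift moves the state by order $h\le\sqrt h$ and the noise by order $\sqrt h$. This gives
the variance of order $h$ of the martingale increments. -/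
theorem abs_increment_le (h1 : h ≤ 1) :
    |ψ (step v h θ (b, z)) - ψ θ|
      ≤ 3 * A ^ 3 * (κ ^ 2) ^ a * √h * dominator W v a q h θ (b, z) := by
  set Y := envelope W v h θ (b, z) with hYdef
  set D := dominator W v a q h θ (b, z)
  have hY : 1 ≤ Y := hW.one_le_envelope h θ (b, z)
  have hA := hW.one_le_A
  have hM := hW.one_le_rpow_κ
  set M := (κ ^ 2) ^ a
  have hq := hW.q_pos
  have hsq : √h ≤ 1 := Real.sqrt_le_one.mpr h1
  have hs0 : 0 ≤ √h := Real.sqrt_nonneg h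
  have hh : h ≤ √h := by nlinarith [Real.sq_sqrt h0.le]
  have hYa : 0 ≤ Y ^ a := Real.rpow_nonneg (by linarith) _
  have hYq : 0 ≤ Y ^ q := Real.rpow_nonneg (by linarith) _
  have hb1 := norm_image_add_sub_le (hW.sol_contDiff.differentiable (by norm_num)) (x := θ)
    (u := (h / 2) • v b θ + √h • z) (G := A * M * Y ^ a) (fun c hc =>
      hW.bound_of_le (by linarith [hW.one_le (θ + c • ((h / 2) • v b θ + √h • z))])
        (hW.fderiv_sol_le _) (by linarith) (hW.step_segment_le h θ b z hc))
  have hu : ‖(h / 2) • v b θ + √h • z‖ ≤ √h * (A * Y ^ q + ‖z‖) := by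
    refine (norm_add_le _ _).trans ?_
    rw [norm_smul, norm_smul, Real.norm_of_nonneg (by positivity), Real.norm_of_nonneg hs0, mul_add]
    have := hW.drift_le_envelope h θ b z
    gcongr
    linarith
  have hD1 : Y ^ a * Y ^ q ≤ D := by
    rw [← Real.rpow_add (by linarith)]
    exact hW.rpow_envelope_le_dominator h θ (b, z) (by linarith)
  have hD2 : Y ^ a ≤ D := hW.rpow_envelope_le_dominator h θ (b, z) (by linarith)
  have hD3 : ‖z‖ ^ 2 * Y ^ a ≤ D := hW.sq_mul_rpow_envelope_le_dominator h θ (b, z)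
  -- Uses $2\|z\|\le 1+\|z\|^2$ and the two bounds before it.
  have hD4 : ‖z‖ * Y ^ a ≤ D := by nlinarith [mul_nonneg hYa (sq_nonneg (‖z‖ - 1))]
  have hD0 : 0 ≤ D := hYa.trans hD2
  have hstep : step v h θ (b, z) = θ + ((h / 2) • v b θ + √h • z) := by simp [step, add_assoc]
  rw [hstep, ← Real.norm_eq_abs]
  have hA2 : A ≤ A ^ 2 := by nlinarith
  have hA3 : A ^ 2 ≤ A ^ 3 := by nlinarith [sq_nonneg A]
  calc _ ≤ A * M * Y ^ a * (√h * (A * Y ^ q + ‖z‖)) :=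
        hb1.trans (mul_le_mul_of_nonneg_left hu (by positivity))
    _ = M * √h * (A ^ 2 * (Y ^ a * Y ^ q) + A * (‖z‖ * Y ^ a)) := by ring
    _ ≤ M * √h * (A ^ 3 * D + A ^ 3 * D) := by
        gcongr
        exact hA2.trans hA3
    _ ≤ _ := by
        have : 0 ≤ M * √h * (A ^ 3 * D) := by positivity
        linarith

/-- Carries the heat-flow expansion from the drift point back to `θ`: `ψ` is expanded to second
order, but `F` only to first, since it already has the factor `h / 2`. The noise `z` occurs only in
the bound, which can therefore be averaged over `z`. -/
theorem abs_drift_expansion_le :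
    |ψ (θ + (h / 2) • v b θ) + h / 2 * F (θ + (h / 2) • v b θ)
        - ψ θ - h / 2 * (fderiv ℝ ψ θ (v b θ) + F θ)|
      ≤ 2 * A ^ 3 * (κ ^ 2) ^ a * h ^ 2 * dominator W v a q h θ (b, z) := by
  set Y := envelope W v h θ (b, z) with hYdef
  set D := dominator W v a q h θ (b, z)
  have hY : 1 ≤ Y := hW.one_le_envelope h θ (b, z)
  have hA := hW.one_le_A
  have hM := hW.one_le_rpow_κ
  set M := (κ ^ 2) ^ a
  have hq := hW.q_pos
  have hYa : 0 ≤ Y ^ a := Real.rpow_nonneg (by linarith) _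
  have hYq : 0 ≤ Y ^ q := Real.rpow_nonneg (by linarith) _
  have hv := hW.drift_le_envelope h θ b z
  have hpos : ∀ c : ℝ, 0 ≤ W (θ + c • (h / 2) • v b θ) := fun c => by
    linarith [hW.one_le (θ + c • (h / 2) • v b θ)]
  have hb1 := norm_image_add_sub_sub_fderiv_le hW.sol_contDiff (x := θ)
    (u := (h / 2) • v b θ) (G := A * M * Y ^ a) (fun c hc =>
      hW.bound_of_le (hpos c) (hW.fderiv_fderiv_sol_le _) (by linarith)
        (hW.drift_segment_le h θ b z hc))
  have hb2 := norm_image_add_sub_le (hW.lap_contDiff.differentiable (by norm_num)) (x := θ)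
    (u := (h / 2) • v b θ) (G := A * M * Y ^ a) (fun c hc =>
      hW.bound_of_le (hpos c) (hW.fderiv_lap_le _) (by linarith)
        (hW.drift_segment_le h θ b z hc))
  have hu : ‖(h / 2) • v b θ‖ ≤ h * (A * Y ^ q) := by
    rw [norm_smul, Real.norm_of_nonneg (by positivity)]
    gcongr
    linarith
  have hD1 : Y ^ a * Y ^ q ≤ D := by
    rw [← Real.rpow_add (by linarith)]
    exact hW.rpow_envelope_le_dominator h θ (b, z) (by linarith)
  have hD2 : Y ^ a * (Y ^ q) ^ 2 ≤ D := by
    rw [← Real.rpow_mul_natCast (by linarith), ← Real.rpow_add (by linarith)]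
    exact hW.rpow_envelope_le_dominator h θ (b, z) (by push_cast; linarith)
  have hD0 : 0 ≤ D := hW.dominator_nonneg h θ (b, z)
  have hA3 : A ^ 2 ≤ A ^ 3 := by nlinarith [sq_nonneg A]
  rw [map_smul, smul_eq_mul] at hb1
  have hb1' : ‖ψ (θ + (h / 2) • v b θ) - ψ θ - h / 2 * fderiv ℝ ψ θ (v b θ)‖
      ≤ M * h ^ 2 * (A ^ 3 * D) := by
    calc _ ≤ A * M * Y ^ a * (h * (A * Y ^ q)) ^ 2 := hb1.trans
          (mul_le_mul_of_nonneg_left (pow_le_pow_left₀ (norm_nonneg _) hu 2) (by positivity))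
      _ = M * h ^ 2 * (A ^ 3 * (Y ^ a * (Y ^ q) ^ 2)) := by ring
      _ ≤ _ := by gcongr
  have hb2' : ‖F (θ + (h / 2) • v b θ) - F θ‖ ≤ M * h * (A ^ 3 * D) := by
    calc _ ≤ A * M * Y ^ a * (h * (A * Y ^ q)) := hb2.trans
          (mul_le_mul_of_nonneg_left hu (by positivity))
      _ = M * h * (A ^ 2 * (Y ^ a * Y ^ q)) := by ring
      _ ≤ _ := by gcongr
  rw [Real.norm_eq_abs, abs_le] at hb1' hb2'
  have hX : 0 ≤ M * h ^ 2 * (A ^ 3 * D) := by positivity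
  rw [abs_le]
  constructor <;> nlinarith

end Pointwise

end GrowthBounds

end OneStep

theorem sq_integral_le_integral_sq {α : Type*} [MeasurableSpace α] {μ : Measure α}
    [IsProbabilityMeasure μ] {f : α → ℝ} (hf : MemLp f 2 μ) :
    (∫ x, f x ∂μ) ^ 2 ≤ ∫ x, f x ^ 2 ∂μ := by
  have h := variance_eq_sub hf
  have h0 := variance_nonneg f μ
  simp only [Pi.pow_apply] at h
  linarith

/-! ### Averages over the mini-batch, the noise and the current state. -/

section OneStepMean

variable {d : ℕ} {β : Type*} [Finite β] [MeasurableSpace β] [MeasurableSingletonClass β]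
  {W ψ F : Param d → ℝ} {v : β → Param d → Param d} {A κ a q : ℝ}

/-- The conditional expectation of `ψ` after one step from `θ`. -/
def stepMean (ψ : Param d → ℝ) (v : β → Param d → Param d) (h : ℝ)
    (law : Measure (β × Param d)) (θ : Param d) : ℝ :=
  ∫ ξ, ψ (step v h θ ξ) ∂law

namespace GrowthBounds

variable (hW : GrowthBounds W ψ F v A κ a q)

include hW

theorem measurable_step (h : ℝ) :
    Measurable fun p : Param d × (β × Param d) => step v h p.1 p.2 := by
  have h1 : Measurable fun p : Param d × β => v p.2 p.1 :=
    measurable_from_prod_countable_left fun b => (hW.drift_continuous b).measurable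
  have h2 : Measurable fun p : Param d × (β × Param d) => v p.2.1 p.1 :=
    h1.comp (measurable_fst.prodMk (measurable_fst.comp measurable_snd))
  exact (measurable_fst.add (h2.const_smul (h / 2))).add
    ((measurable_snd.comp measurable_snd).const_smul √h)

theorem measurable_envelope (h : ℝ) :
    Measurable fun p : Param d × (β × Param d) => envelope W v h p.1 p.2 := by
  have h1 := hW.measurable.comp (hW.measurable_step h)
  have hn : Measurable fun p : Param d × (β × Param d) => (p.1, (p.2.1, -p.2.2)) := by fun_prop
  have h2 := h1.comp hn
  exact (hW.measurable.comp measurable_fst).max (h1.max h2)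

theorem measurable_dominator (h : ℝ) :
    Measurable fun p : Param d × (β × Param d) => dominator W v a q h p.1 p.2 := by
  have := hW.measurable_envelope h
  unfold dominator
  fun_prop

/-- The heat flow from the drift point with $\sigma=\sqrt h$ costs one unit of $A^3(\kappa^2)^a
h^2$, and the drift expansion costs two; hence the 3. -/
theorem abs_integral_step_noise_sub_le {h : ℝ} (h0 : 0 < h) (θ : Param d) (b : β)
    (hD : Integrable (fun z => dominator W v a q h θ (b, z)) (stdGaussian (Param d))) :
    |∫ z, ψ (step v h θ (b, z)) ∂(stdGaussian (Param d)) - ψ θ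
        - h / 2 * (fderiv ℝ ψ θ (v b θ) + F θ)|
      ≤ 3 * A ^ 3 * (κ ^ 2) ^ a * h ^ 2
        * ∫ z, dominator W v a q h θ (b, z) ∂(stdGaussian (Param d)) := by
  have hA := hW.one_le_A
  have hM := hW.one_le_rpow_κ
  have hq := hW.q_pos
  set M := (κ ^ 2) ^ a
  have hYm : Measurable fun z => envelope W v h θ (b, z) :=
    (hW.measurable_envelope h).comp (by fun_prop : Measurable fun z : Param d => (θ, (b, z)))
  have hYnn : ∀ z, 0 ≤ envelope W v h θ (b, z) := fun z =>
    zero_le_one.trans (hW.one_le_envelope h θ (b, z))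
  have hYann : ∀ z, 0 ≤ envelope W v h θ (b, z) ^ a := fun z => Real.rpow_nonneg (hYnn z) _
  have hGi : Integrable (fun z => A * M * envelope W v h θ (b, z) ^ a)
      (stdGaussian (Param d)) := by
    refine (hD.mono' (hYm.pow_const a).aestronglyMeasurable (ae_of_all _ fun z => ?_)).const_mul _
    rw [Real.norm_of_nonneg (hYann z)]
    exact hW.rpow_envelope_le_dominator h θ (b, z) (by linarith)
  have hG2 : Integrable (fun z => ‖z‖ ^ 2 * envelope W v h θ (b, z) ^ a)
      (stdGaussian (Param d)) := by
    refine hD.mono' (by fun_prop) (ae_of_all _ fun z => ?_)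
    rw [Real.norm_of_nonneg (mul_nonneg (sq_nonneg _) (hYann z))]
    exact hW.sq_mul_rpow_envelope_le_dominator h θ (b, z)
  have hG2' : Integrable (fun z => ‖z‖ ^ 2 * (A * M * envelope W v h θ (b, z) ^ a))
      (stdGaussian (Param d)) := by
    refine (hG2.const_mul (A * M)).congr (ae_of_all _ fun z => ?_)
    ring
  have hbd : ∀ z, ∀ s ∈ Set.Icc 0 √h, ∀ x, x ≤ A * W (θ + (h / 2) • v b θ + s • z) ^ a →
      x ≤ A * M * envelope W v h θ (b, z) ^ a := fun z s hs x hx =>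
    hW.bound_of_le (by linarith [hW.one_le (θ + (h / 2) • v b θ + s • z)]) hx (hYnn z)
      (hW.noise_segment_le h θ b z hs)
  have hheat := (abs_integral_add_smul_stdGaussian_sub_le hW.sol_contDiff hW.lap_contDiff hW.lap_eq
    (θ + (h / 2) • v b θ) (Real.sqrt_nonneg h) hGi hG2'
    (fun z s hs => hbd z s hs _ (hW.fderiv_sol_le _))
    (fun z s hs => hbd z s hs _ (hW.fderiv_fderiv_sol_le _))
    (fun z s hs => hbd z s hs _ (hW.fderiv_fderiv_lap_le _))).2
  have e4 : √h ^ 4 = h ^ 2 := by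
    rw [show (4 : ℕ) = 2 * 2 by norm_num, pow_mul, Real.sq_sqrt h0.le]
  rw [e4, Real.sq_sqrt h0.le] at hheat
  set D := ∫ z, dominator W v a q h θ (b, z) ∂(stdGaussian (Param d)) with hDdef
  have hD0 : 0 ≤ D := integral_nonneg fun z => hW.dominator_nonneg h θ (b, z)
  have hA3 : A ≤ A ^ 3 := le_self_pow₀ hA (by norm_num)
  have hheat' : h ^ 2 * ∫ z, ‖z‖ ^ 2 * (A * M * envelope W v h θ (b, z) ^ a)
      ∂(stdGaussian (Param d)) ≤ A ^ 3 * M * h ^ 2 * D := by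
    calc _ = A * M * h ^ 2 * ∫ z, ‖z‖ ^ 2 * envelope W v h θ (b, z) ^ a
          ∂(stdGaussian (Param d)) := by
          have e : ∀ z : Param d, ‖z‖ ^ 2 * (A * M * envelope W v h θ (b, z) ^ a)
              = A * M * (‖z‖ ^ 2 * envelope W v h θ (b, z) ^ a) := fun z => by ring
          simp_rw [e]
          rw [integral_const_mul]
          ring
      _ ≤ A * M * h ^ 2 * D := mul_le_mul_of_nonneg_left (integral_mono hG2 hD
          fun z => hW.sq_mul_rpow_envelope_le_dominator h θ (b, z)) (by positivity)
      _ ≤ _ := by gcongr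
  have hdrift : |ψ (θ + (h / 2) • v b θ) + h / 2 * F (θ + (h / 2) • v b θ)
        - ψ θ - h / 2 * (fderiv ℝ ψ θ (v b θ) + F θ)| ≤ 2 * A ^ 3 * M * h ^ 2 * D := by
    rw [hDdef, ← integral_const_mul]
    have := integral_mono (μ := stdGaussian (Param d)) (integrable_const _)
      (hD.const_mul (2 * A ^ 3 * M * h ^ 2)) (fun z => hW.abs_drift_expansion_le θ b z h0)
    simpa using this
  simp only [step]
  have h5 := hheat.trans hheat'
  rw [abs_le] at h5 hdrift ⊢
  constructor <;> linarith [h5.1, h5.2, hdrift.1, hdrift.2]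

variable {π : Measure β} [IsProbabilityMeasure π]

theorem integrable_sol_step {h : ℝ} (h0 : 0 < h) (h1 : h ≤ 1) (θ : Param d)
    (hD : Integrable (dominator W v a q h θ) (π.prod (stdGaussian (Param d)))) :
    Integrable (fun ξ => ψ (step v h θ ξ)) (π.prod (stdGaussian (Param d))) := by
  have hm : Measurable fun ξ => ψ (step v h θ ξ) :=
    hW.sol_contDiff.continuous.measurable.comp ((hW.measurable_step h).comp measurable_prodMk_left)
  refine ((integrable_const |ψ θ|).add
    (hD.const_mul (3 * A ^ 3 * (κ ^ 2) ^ a * √h))).mono' hm.aestronglyMeasurable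
    (ae_of_all _ fun ξ => ?_)
  have h2 := hW.abs_increment_le θ ξ.1 ξ.2 h0 h1
  have h3 := abs_sub_abs_le_abs_sub (ψ (step v h θ ξ)) (ψ θ)
  simp only [Pi.add_apply, Real.norm_eq_abs, Prod.mk.eta] at *
  linarith

/-- For fixed `θ` the main term is affine in the drift, so averaging over batches leaves only the
mean drift. -/
theorem abs_stepMean_sub_le {h : ℝ} (h0 : 0 < h) (h1 : h ≤ 1) (θ : Param d)
    (hD : Integrable (dominator W v a q h θ) (π.prod (stdGaussian (Param d)))) :
    |stepMean ψ v h (π.prod (stdGaussian (Param d))) θ - ψ θ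
        - h / 2 * (fderiv ℝ ψ θ (∫ b, v b θ ∂π) + F θ)|
      ≤ 3 * A ^ 3 * (κ ^ 2) ^ a * h ^ 2
        * ∫ ξ, dominator W v a q h θ ξ ∂(π.prod (stdGaussian (Param d))) := by
  have hψi := hW.integrable_sol_step h0 h1 θ hD
  have hvi : Integrable (fun b => v b θ) π := .of_finite
  have hvi' : Integrable (fun b => h / 2 * (fderiv ℝ ψ θ (v b θ) + F θ)) π := .of_finite
  have hc : Integrable (fun _ : β => ψ θ) π := integrable_const _
  have e1 : h / 2 * (fderiv ℝ ψ θ (∫ b, v b θ ∂π) + F θ)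
      = ∫ b, h / 2 * (fderiv ℝ ψ θ (v b θ) + F θ) ∂π := by
    rw [integral_const_mul, integral_add ((fderiv ℝ ψ θ).integrable_comp hvi) (integrable_const _),
      ContinuousLinearMap.integral_comp_comm _ hvi]
    simp
  have e2 : ψ θ = ∫ _ : β, ψ θ ∂π := by simp
  have hp := hψi.integral_prod_left
  rw [e1, stepMean, integral_prod _ hψi]
  nth_rewrite 1 [e2]
  have hpc : Integrable (fun b => ∫ z, ψ (step v h θ (b, z)) ∂(stdGaussian (Param d)) - ψ θ) π :=
    hp.sub hc
  rw [← integral_sub hp hc, ← integral_sub hpc hvi', integral_prod _ hD,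
    ← integral_const_mul, ← Real.norm_eq_abs]
  refine norm_integral_le_of_norm_le (hD.integral_prod_left.const_mul _) ?_
  filter_upwards [hD.prod_right_ae] with b hb
  exact hW.abs_integral_step_noise_sub_le h0 θ b hb

omit [IsProbabilityMeasure π] in
theorem measurable_generator (π : Measure β) [SFinite π] :
    Measurable fun θ => fderiv ℝ ψ θ (∫ b, v b θ ∂π) + F θ := by
  have hvm : Measurable fun θ => ∫ b, v b θ ∂π := by
    have : StronglyMeasurable fun p : Param d × β => v p.2 p.1 :=
      (measurable_from_prod_countable_left fun b =>
        (hW.drift_continuous b).measurable).stronglyMeasurable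
    exact this.integral_prod_right'.measurable
  have hd : Continuous fun p : Param d × Param d => fderiv ℝ ψ p.1 p.2 := by
    have := hW.sol_contDiff.continuous_fderiv (by norm_num)
    fun_prop
  exact (hd.measurable.comp (measurable_id.prodMk hvm)).add
    hW.lap_contDiff.continuous.measurable

section Stationary

variable {ν : Measure (Param d)} [IsProbabilityMeasure ν]

/-- A uniform bound on the second moment of the dominator. -/
theorem integrable_sq_dominator {h K : ℝ}
    (hν : Integrable (fun θ => W θ ^ (2 * a + 4 * q)) ν)
    (hνK : ∫ θ, W θ ^ (2 * a + 4 * q) ∂ν ≤ K)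
    (hs : Integrable (fun p : Param d × (β × Param d) => W (step v h p.1 p.2) ^ (2 * a + 4 * q))
      (ν.prod (π.prod (stdGaussian (Param d)))))
    (hsK : ∫ p : Param d × (β × Param d), W (step v h p.1 p.2) ^ (2 * a + 4 * q)
      ∂(ν.prod (π.prod (stdGaussian (Param d)))) ≤ K) :
    Integrable (fun p : Param d × (β × Param d) => dominator W v a q h p.1 p.2 ^ 2)
      (ν.prod (π.prod (stdGaussian (Param d)))) ∧
    ∫ p : Param d × (β × Param d), dominator W v a q h p.1 p.2 ^ 2
      ∂(ν.prod (π.prod (stdGaussian (Param d))))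
      ≤ 2 * (∫ z : Param d, ‖z‖ ^ (2 * ((a + 2 * q) / q)) ∂(stdGaussian (Param d)) + 3 * K) := by
  have ha := hW.a_pos
  have hq := hW.q_pos
  set μ := ν.prod (π.prod (stdGaussian (Param d)))
  -- The Gaussian law is symmetric, so the reflected step has the same moments of `W` as the step.
  have hneg : MeasurePreserving (fun p : Param d × (β × Param d) => (p.1, (p.2.1, -p.2.2))) μ μ :=
    (MeasurePreserving.id ν).prod ((MeasurePreserving.id π).prod
      ⟨measurable_neg, map_neg_stdGaussian⟩)
  have hsm : Measurable fun p : Param d × (β × Param d) =>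
      W (step v h p.1 p.2) ^ (2 * a + 4 * q) :=
    (hW.measurable.comp (hW.measurable_step h)).pow_const _
  have hn : Integrable (fun p : Param d × (β × Param d) =>
      W (step v h p.1 (p.2.1, -p.2.2)) ^ (2 * a + 4 * q)) μ :=
    (hneg.integrable_comp hsm.aestronglyMeasurable).2 hs
  have hnK : ∫ p : Param d × (β × Param d),
      W (step v h p.1 (p.2.1, -p.2.2)) ^ (2 * a + 4 * q) ∂μ ≤ K := by
    have := integral_map hneg.measurable.aemeasurable (μ := μ)
      (f := fun p : Param d × (β × Param d) => W (step v h p.1 p.2) ^ (2 * a + 4 * q))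
      hsm.aestronglyMeasurable
    rw [hneg.map_eq] at this
    rw [← this]
    exact hsK
  have hθ : Integrable (fun p : Param d × (β × Param d) => W p.1 ^ (2 * a + 4 * q)) μ :=
    hν.comp_fst _
  have hθK : ∫ p : Param d × (β × Param d), W p.1 ^ (2 * a + 4 * q) ∂μ ≤ K := by
    rw [integral_fun_fst (μ := ν) (fun θ => W θ ^ (2 * a + 4 * q))]
    simpa using hνK
  have hz0 : Integrable (fun z : Param d => ‖z‖ ^ (2 * ((a + 2 * q) / q)))
      (stdGaussian (Param d)) := integrable_norm_rpow_stdGaussian (by positivity)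
  have hz1 : Integrable (fun ξ : β × Param d => ‖ξ.2‖ ^ (2 * ((a + 2 * q) / q)))
      (π.prod (stdGaussian (Param d))) := hz0.comp_snd π
  have hz : Integrable (fun p : Param d × (β × Param d) => ‖p.2.2‖ ^ (2 * ((a + 2 * q) / q))) μ :=
    hz1.comp_snd ν
  have hzK : ∫ p : Param d × (β × Param d), ‖p.2.2‖ ^ (2 * ((a + 2 * q) / q)) ∂μ
      = ∫ z : Param d, ‖z‖ ^ (2 * ((a + 2 * q) / q)) ∂(stdGaussian (Param d)) := by
    rw [integral_fun_snd (ν := π.prod (stdGaussian (Param d)))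
      (fun ξ : β × Param d => ‖ξ.2‖ ^ (2 * ((a + 2 * q) / q))),
      integral_fun_snd (μ := π) (fun z : Param d => ‖z‖ ^ (2 * ((a + 2 * q) / q)))]
    simp
  have hsum : Integrable (fun p : Param d × (β × Param d) =>
      2 * (‖p.2.2‖ ^ (2 * ((a + 2 * q) / q)) + (W p.1 ^ (2 * a + 4 * q)
        + (W (step v h p.1 p.2) ^ (2 * a + 4 * q)
        + W (step v h p.1 (p.2.1, -p.2.2)) ^ (2 * a + 4 * q))))) μ :=
    (hz.add (hθ.add (hs.add hn))).const_mul 2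
  have hle : ∀ p : Param d × (β × Param d), dominator W v a q h p.1 p.2 ^ 2 ≤
      2 * (‖p.2.2‖ ^ (2 * ((a + 2 * q) / q)) + (W p.1 ^ (2 * a + 4 * q)
        + (W (step v h p.1 p.2) ^ (2 * a + 4 * q)
        + W (step v h p.1 (p.2.1, -p.2.2)) ^ (2 * a + 4 * q)))) := by
    intro p
    have hp : ∀ θ, 0 ≤ W θ ^ (2 * a + 4 * q) := fun θ =>
      Real.rpow_nonneg (zero_le_one.trans (hW.one_le θ)) _
    have h1 : envelope W v h p.1 p.2 ^ (2 * a + 4 * q) ≤ W p.1 ^ (2 * a + 4 * q)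
        + (W (step v h p.1 p.2) ^ (2 * a + 4 * q)
        + W (step v h p.1 (p.2.1, -p.2.2)) ^ (2 * a + 4 * q)) := by
      unfold envelope
      rcases max_choice (W p.1) (max (W (step v h p.1 p.2)) (W (step v h p.1 (p.2.1, -p.2.2))))
        with hm | hm <;> rw [hm]
      · linarith [hp (step v h p.1 p.2), hp (step v h p.1 (p.2.1, -p.2.2))]
      · rcases max_choice (W (step v h p.1 p.2)) (W (step v h p.1 (p.2.1, -p.2.2)))
          with hm | hm <;> rw [hm]
        · linarith [hp p.1, hp (step v h p.1 (p.2.1, -p.2.2))]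
        · linarith [hp p.1, hp (step v h p.1 p.2)]
    have h2 : (‖p.2.2‖ ^ ((a + 2 * q) / q)) ^ 2 = ‖p.2.2‖ ^ (2 * ((a + 2 * q) / q)) := by
      rw [← Real.rpow_mul_natCast (norm_nonneg _)]; congr 1; push_cast; ring
    have h3 : (envelope W v h p.1 p.2 ^ (a + 2 * q)) ^ 2
        = envelope W v h p.1 p.2 ^ (2 * a + 4 * q) := by
      rw [← Real.rpow_mul_natCast (zero_le_one.trans (hW.one_le_envelope h p.1 p.2))]
      congr 1; push_cast; ring
    unfold dominator
    rw [← h2]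
    -- This is $(x+y)^2\le 2(x^2+y^2)$, with the maximum in the envelope bounded by the sum of its
    -- three entries; hence `2 * (… + 3 * K)`.
    nlinarith [sq_nonneg (‖p.2.2‖ ^ ((a + 2 * q) / q) - envelope W v h p.1 p.2 ^ (a + 2 * q))]
  have hi : Integrable (fun p : Param d × (β × Param d) => dominator W v a q h p.1 p.2 ^ 2) μ :=
    hsum.mono' ((hW.measurable_dominator h).pow_const 2).aestronglyMeasurable
      (ae_of_all _ fun p => by rw [Real.norm_of_nonneg (sq_nonneg _)]; exact hle p)
  refine ⟨hi, (integral_mono hi hsum hle).trans ?_⟩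
  have hsn : Integrable (fun p : Param d × (β × Param d) => W (step v h p.1 p.2) ^ (2 * a + 4 * q)
      + W (step v h p.1 (p.2.1, -p.2.2)) ^ (2 * a + 4 * q)) μ := hs.add hn
  have hθsn : Integrable (fun p : Param d × (β × Param d) => W p.1 ^ (2 * a + 4 * q)
      + (W (step v h p.1 p.2) ^ (2 * a + 4 * q)
      + W (step v h p.1 (p.2.1, -p.2.2)) ^ (2 * a + 4 * q))) μ := hθ.add hsn
  rw [integral_const_mul, integral_add hz hθsn, integral_add hθ hsn, integral_add hs hn, hzK]
  linarith

/-- The centred increment and the bias of one step are small in mean square. -/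
theorem step_mean_square {h K : ℝ} (h0 : 0 < h) (h1 : h ≤ 1)
    (hD : Integrable (fun p : Param d × (β × Param d) => dominator W v a q h p.1 p.2 ^ 2)
      (ν.prod (π.prod (stdGaussian (Param d)))))
    (hK : ∫ p : Param d × (β × Param d), dominator W v a q h p.1 p.2 ^ 2
      ∂(ν.prod (π.prod (stdGaussian (Param d)))) ≤ K) :
    (∀ᵐ θ ∂ν, Integrable (fun ξ => ψ (step v h θ ξ)) (π.prod (stdGaussian (Param d)))) ∧
    MemLp (fun p : Param d × (β × Param d) =>
      ψ (step v h p.1 p.2) - stepMean ψ v h (π.prod (stdGaussian (Param d))) p.1) 2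
      (ν.prod (π.prod (stdGaussian (Param d)))) ∧
    ∫ p : Param d × (β × Param d),
      (ψ (step v h p.1 p.2) - stepMean ψ v h (π.prod (stdGaussian (Param d))) p.1) ^ 2
      ∂(ν.prod (π.prod (stdGaussian (Param d))))
      ≤ 4 * (3 * A ^ 3 * (κ ^ 2) ^ a) ^ 2 * h * K ∧
    MemLp (fun θ => stepMean ψ v h (π.prod (stdGaussian (Param d))) θ - ψ θ
      - h / 2 * (fderiv ℝ ψ θ (∫ b, v b θ ∂π) + F θ)) 2 ν ∧
    ∫ θ, (stepMean ψ v h (π.prod (stdGaussian (Param d))) θ - ψ θ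
      - h / 2 * (fderiv ℝ ψ θ (∫ b, v b θ ∂π) + F θ)) ^ 2 ∂ν
      ≤ (3 * A ^ 3 * (κ ^ 2) ^ a) ^ 2 * h ^ 4 * K := by
  set lam := π.prod (stdGaussian (Param d)) with hlam
  set C := 3 * A ^ 3 * (κ ^ 2) ^ a with hC
  have hA := hW.one_le_A
  have hM := hW.one_le_rpow_κ
  have hC0 : 0 ≤ C := by positivity
  have hDm := hW.measurable_dominator h
  have hDL : MemLp (fun p : Param d × (β × Param d) => dominator W v a q h p.1 p.2) 2
      (ν.prod lam) := (memLp_two_iff_integrable_sq hDm.aestronglyMeasurable).2 hD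
  have hDae : ∀ᵐ θ ∂ν, MemLp (dominator W v a q h θ) 2 lam := by
    filter_upwards [hD.prod_right_ae] with θ hθ
    exact (memLp_two_iff_integrable_sq
      (hDm.comp measurable_prodMk_left).aestronglyMeasurable).2 hθ
  have hDi : ∀ᵐ θ ∂ν, Integrable (dominator W v a q h θ) lam := by
    filter_upwards [hDae] with θ hθ using hθ.integrable (by norm_num)
  have hψi : ∀ᵐ θ ∂ν, Integrable (fun ξ => ψ (step v h θ ξ)) lam := by
    filter_upwards [hDi] with θ hθ using hW.integrable_sol_step h0 h1 θ hθ
  have hbarm : StronglyMeasurable fun θ => ∫ ξ, dominator W v a q h θ ξ ∂lam :=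
    StronglyMeasurable.integral_prod_right' (ν := lam)
      (f := fun p : Param d × (β × Param d) => dominator W v a q h p.1 p.2) hDm.stronglyMeasurable
  have hmeanm : StronglyMeasurable (stepMean ψ v h lam) :=
    StronglyMeasurable.integral_prod_right' (ν := lam)
      (f := fun p : Param d × (β × Param d) => ψ (step v h p.1 p.2))
      (hW.sol_contDiff.continuous.measurable.comp (hW.measurable_step h)).stronglyMeasurable
  have hbari : Integrable (fun θ => (∫ ξ, dominator W v a q h θ ξ ∂lam) ^ 2) ν := by
    refine hD.integral_prod_left.mono' (hbarm.pow 2).aestronglyMeasurable ?_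
    filter_upwards [hDae] with θ hθ
    rw [Real.norm_of_nonneg (sq_nonneg _)]
    exact sq_integral_le_integral_sq hθ
  have hbarK : ∫ θ, (∫ ξ, dominator W v a q h θ ξ ∂lam) ^ 2 ∂ν ≤ K := by
    refine le_trans ?_ hK
    rw [integral_prod _ hD]
    refine integral_mono_ae hbari hD.integral_prod_left ?_
    filter_upwards [hDae] with θ hθ using sq_integral_le_integral_sq hθ
  -- The centred increment is the increment minus its conditional mean; both are of order $\sqrt h$,
  -- with the dominator and its average over the inputs as factors. Jensen gives the squared average
  -- the same bound `K`.
  have hinc : ∀ᵐ p ∂(ν.prod lam), (ψ (step v h p.1 p.2) - stepMean ψ v h lam p.1) ^ 2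
      ≤ 2 * C ^ 2 * h * (dominator W v a q h p.1 p.2 ^ 2
        + (∫ ξ, dominator W v a q h p.1 ξ ∂lam) ^ 2) := by
    filter_upwards [Measure.quasiMeasurePreserving_fst.ae hDi,
      Measure.quasiMeasurePreserving_fst.ae hψi] with p hp hpψ
    have h2 := hW.abs_increment_le p.1 p.2.1 p.2.2 h0 h1
    have h3 : |stepMean ψ v h lam p.1 - ψ p.1|
        ≤ C * √h * ∫ ξ, dominator W v a q h p.1 ξ ∂lam := by
      have e : stepMean ψ v h lam p.1 - ψ p.1 = ∫ ξ, (ψ (step v h p.1 ξ) - ψ p.1) ∂lam := by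
        rw [integral_sub hpψ (integrable_const _)]; simp [stepMean]
      rw [e, ← integral_const_mul, ← Real.norm_eq_abs]
      refine norm_integral_le_of_norm_le (hp.const_mul _) (ae_of_all _ fun ξ => ?_)
      exact hW.abs_increment_le p.1 ξ.1 ξ.2 h0 h1
    have h4 : |ψ (step v h p.1 p.2) - stepMean ψ v h lam p.1| ≤ C * √h *
        (dominator W v a q h p.1 p.2 + ∫ ξ, dominator W v a q h p.1 ξ ∂lam) := by
      rw [mul_add]
      refine le_trans ?_ (add_le_add h2 h3)
      rw [abs_sub_comm (stepMean ψ v h lam p.1)]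
      refine le_trans (le_of_eq ?_) (abs_add_le _ _)
      congr 1; simp
    rw [← sq_abs]
    calc _ ≤ (C * √h * (dominator W v a q h p.1 p.2
          + ∫ ξ, dominator W v a q h p.1 ξ ∂lam)) ^ 2 := pow_le_pow_left₀ (abs_nonneg _) h4 2
      _ = C ^ 2 * h * (dominator W v a q h p.1 p.2
          + ∫ ξ, dominator W v a q h p.1 ξ ∂lam) ^ 2 := by
          rw [mul_pow, mul_pow, Real.sq_sqrt h0.le]
      _ ≤ C ^ 2 * h * (2 * (dominator W v a q h p.1 p.2 ^ 2
          + (∫ ξ, dominator W v a q h p.1 ξ ∂lam) ^ 2)) :=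
          mul_le_mul_of_nonneg_left (add_sq_le) (by positivity)
      _ = _ := by ring
  have hbari' : Integrable (fun p : Param d × (β × Param d) =>
      (∫ ξ, dominator W v a q h p.1 ξ ∂lam) ^ 2) (ν.prod lam) := hbari.comp_fst lam
  have hMm : AEStronglyMeasurable (fun p : Param d × (β × Param d) =>
      ψ (step v h p.1 p.2) - stepMean ψ v h lam p.1) (ν.prod lam) :=
    ((hW.sol_contDiff.continuous.measurable.comp (hW.measurable_step h)).sub
      (hmeanm.measurable.comp measurable_fst)).aestronglyMeasurable
  have hdomi : Integrable (fun p : Param d × (β × Param d) =>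
      2 * C ^ 2 * h * (dominator W v a q h p.1 p.2 ^ 2
        + (∫ ξ, dominator W v a q h p.1 ξ ∂lam) ^ 2)) (ν.prod lam) :=
    (hD.add hbari').const_mul _
  have hMi : Integrable (fun p : Param d × (β × Param d) =>
      (ψ (step v h p.1 p.2) - stepMean ψ v h lam p.1) ^ 2) (ν.prod lam) := by
    refine hdomi.mono' (hMm.pow 2) ?_
    filter_upwards [hinc] with p hp
    rwa [Real.norm_of_nonneg (sq_nonneg _)]
  have hbias : ∀ᵐ θ ∂ν, (stepMean ψ v h lam θ - ψ θ
      - h / 2 * (fderiv ℝ ψ θ (∫ b, v b θ ∂π) + F θ)) ^ 2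
      ≤ C ^ 2 * h ^ 4 * (∫ ξ, dominator W v a q h θ ξ ∂lam) ^ 2 := by
    filter_upwards [hDi] with θ hθ
    rw [← sq_abs]
    refine (pow_le_pow_left₀ (abs_nonneg _) (hW.abs_stepMean_sub_le h0 h1 θ hθ) 2).trans_eq ?_
    ring
  have hAm : AEStronglyMeasurable (fun θ => stepMean ψ v h lam θ - ψ θ
      - h / 2 * (fderiv ℝ ψ θ (∫ b, v b θ ∂π) + F θ)) ν := by
    exact ((hmeanm.measurable.sub hW.sol_contDiff.continuous.measurable).sub
      ((hW.measurable_generator π).const_mul _)).aestronglyMeasurable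
  have hAi : Integrable (fun θ => (stepMean ψ v h lam θ - ψ θ
      - h / 2 * (fderiv ℝ ψ θ (∫ b, v b θ ∂π) + F θ)) ^ 2) ν := by
    refine (hbari.const_mul (C ^ 2 * h ^ 4)).mono' (hAm.pow 2) ?_
    filter_upwards [hbias] with θ hθ
    rwa [Real.norm_of_nonneg (sq_nonneg _)]
  refine ⟨hψi, (memLp_two_iff_integrable_sq hMm).2 hMi, ?_,
    (memLp_two_iff_integrable_sq hAm).2 hAi, ?_⟩
  · refine (integral_mono_ae hMi hdomi hinc).trans ?_
    rw [integral_const_mul, integral_add hD hbari',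
      integral_fun_fst (μ := ν) (fun θ => (∫ ξ, dominator W v a q h θ ξ ∂lam) ^ 2)]
    rw [probReal_univ, one_smul]
    calc _ ≤ 2 * C ^ 2 * h * (K + K) :=
          mul_le_mul_of_nonneg_left (add_le_add hK hbarK) (by positivity)
      _ = _ := by ring
  · refine (integral_mono_ae hAi (hbari.const_mul (C ^ 2 * h ^ 4)) hbias).trans ?_
    rw [integral_const_mul]
    exact mul_le_mul_of_nonneg_left hbarK (by positivity)

end Stationary

end GrowthBounds

end OneStepMean

/-! ### Independence of the current state and the next input. -/

section Independence

variable {Ω : Type*} [MeasurableSpace Ω] {P : Measure Ω} [IsProbabilityMeasure P]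
  {α α' α'' : Type*} [MeasurableSpace α] [MeasurableSpace α'] [MeasurableSpace α'']

/-- The joint law of the three variables factorises completely, and the product is then
reassociated. -/
theorem indepFun_prodMk_of_indepFun_prodMk {X : Ω → α} {Y : Ω → α'} {V : Ω → α''}
    (hX : Measurable X) (hY : Measurable Y) (hV : Measurable V)
    (h : IndepFun X (fun ω => (Y ω, V ω)) P) (hYV : IndepFun Y V P) :
    IndepFun (fun ω => (X ω, Y ω)) V P := by
  have hXY : IndepFun X Y P := h.comp measurable_id measurable_fst
  rw [indepFun_iff_map_prod_eq_prod_map_map (by fun_prop) (by fun_prop)] at h hYV hXY ⊢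
  have := Measure.isProbabilityMeasure_map (μ := P) hX.aemeasurable
  have := Measure.isProbabilityMeasure_map (μ := P) hY.aemeasurable
  have := Measure.isProbabilityMeasure_map (μ := P) hV.aemeasurable
  rw [hYV, ← Measure.prodAssoc_prod, ← hXY] at h
  have h' := congrArg (Measure.map MeasurableEquiv.prodAssoc.symm) h
  rw [Measure.map_map (by fun_prop) (by fun_prop), Measure.map_map (by fun_prop) (by fun_prop)] at h'
  simp only [Function.comp_def, MeasurableEquiv.symm_apply_apply] at h'
  exact h'.trans Measure.map_id'

/-- The state of a recursion that is driven by independent inputs is independent of the next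
input. -/
theorem indepFun_state_input {X₀ : Ω → α} {ξ : ℕ → Ω → α'} (hX₀ : Measurable X₀)
    (hξ : ∀ t, Measurable (ξ t)) (hindep : iIndepFun ξ P)
    (hX₀_indep : IndepFun X₀ (fun ω t => ξ t ω) P) {X : ℕ → Ω → α''} {i : α → α''} (hi : Measurable i)
    {u : α'' × α' → α''} (hu : Measurable u) (hX_zero : ∀ ω, X 0 ω = i (X₀ ω))
    (hX_succ : ∀ t ω, X (t + 1) ω = u (X t ω, ξ t ω)) (t : ℕ) : IndepFun (X t) (ξ t) P := by
  -- The state at time `t` is a measurable function of the initial value and the inputs before `t`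
  -- only.
  have hfun : ∀ t, ∃ Φ : α × (Finset.range t → α') → α'', Measurable Φ ∧
      ∀ ω, X t ω = Φ (X₀ ω, fun j => ξ j ω) := by
    intro t
    induction t with
    | zero => exact ⟨fun x => i x.1, by fun_prop, hX_zero⟩
    | succ t ih =>
      obtain ⟨Φ, hΦ, hX⟩ := ih
      refine ⟨fun x => u (Φ (x.1, fun j => x.2 ⟨j, Finset.mem_range.2
        ((Finset.mem_range.1 j.2).trans (Nat.lt_succ_self t))⟩),
        x.2 ⟨t, Finset.mem_range.2 (Nat.lt_succ_self t)⟩), by fun_prop, fun ω => ?_⟩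
      rw [hX_succ, hX]
  obtain ⟨Φ, hΦ, hX⟩ := hfun t
  have hpast : IndepFun (fun ω (j : Finset.range t) => ξ j ω) (ξ t) P := by
    have := hindep.indepFun_finset (Finset.range t) {t} (by simp) hξ
    exact this.comp measurable_id (measurable_pi_apply (⟨t, by simp⟩ : ({t} : Finset ℕ)))
  have hjoint : IndepFun X₀ (fun ω => ((fun j : Finset.range t => ξ j ω), ξ t ω)) P :=
    hX₀_indep.comp measurable_id
      (by fun_prop : Measurable fun s : ℕ → α' => ((fun j : Finset.range t => s j), s t))
  have := (indepFun_prodMk_of_indepFun_prodMk hX₀ (by fun_prop) (hξ t) hjoint hpast).comp hΦ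
    measurable_id
  have e : X t = Φ ∘ fun ω => (X₀ ω, fun j : Finset.range t => ξ j ω) := funext hX
  rw [e]
  exact this

end Independence

section Noise

variable {d : ℕ} {β : Type*} [Finite β] [MeasurableSpace β] [MeasurableSingletonClass β]
  {Ω : Type*} [MeasurableSpace Ω] {P : Measure Ω} [IsProbabilityMeasure P] {w : β → ℝ}
  {θ₀ : Ω → Param d} {B : ℕ → Ω → β} {Z : ℕ → Ω → Param d}

namespace IsDrivingNoise

variable (hN : IsDrivingNoise P w θ₀ B Z)

include hN

theorem map_batch (t : ℕ) : P.map (B t) = P.map (B 0) := by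
  refine Measure.ext_of_singleton fun b => ?_
  rw [Measure.map_apply (hN.measurable_batch t) (measurableSet_singleton b),
    Measure.map_apply (hN.measurable_batch 0) (measurableSet_singleton b),
    ← measureReal_eq_measureReal_iff, hN.batch_law, hN.batch_law]

theorem map_input (t : ℕ) : P.map (fun ω => (B t ω, Z t ω))
    = (P.map (B 0)).prod (stdGaussian (Param d)) := by
  rw [(indepFun_iff_map_prod_eq_prod_map_map (hN.measurable_batch t).aemeasurable
    (hN.measurable_noise t).aemeasurable).1 (hN.indep_batch_noise t), hN.map_batch, hN.noise_law]

end IsDrivingNoise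

end Noise

theorem integral_sq_sum_le {Ω : Type*} [MeasurableSpace Ω] {P : Measure Ω} {ι : Type*}
    (s : Finset ι) {f : ι → Ω → ℝ} {K : ℝ} (hf : ∀ i ∈ s, MemLp (f i) 2 P)
    (hK : ∀ i ∈ s, ∫ ω, f i ω ^ 2 ∂P ≤ K) :
    ∫ ω, (∑ i ∈ s, f i ω) ^ 2 ∂P ≤ (s.card : ℝ) ^ 2 * K := by
  have hi : ∀ i ∈ s, Integrable (fun ω => f i ω ^ 2) P := fun i hi => (hf i hi).integrable_sq
  calc ∫ ω, (∑ i ∈ s, f i ω) ^ 2 ∂P ≤ ∫ ω, (s.card : ℝ) * ∑ i ∈ s, f i ω ^ 2 ∂P :=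
        integral_mono (memLp_finsetSum s hf).integrable_sq
          ((integrable_finsetSum s hi).const_mul _) fun ω => sq_sum_le_card_mul_sum_sq
    _ = (s.card : ℝ) * ∑ i ∈ s, ∫ ω, f i ω ^ 2 ∂P := by
        rw [integral_const_mul, integral_finsetSum s hi]
    _ ≤ (s.card : ℝ) * ∑ i ∈ s, K :=
        mul_le_mul_of_nonneg_left (Finset.sum_le_sum hK) (Nat.cast_nonneg _)
    _ = _ := by rw [Finset.sum_const, nsmul_eq_mul]; ring

/-! ### The one-step estimates along the chain, and orthogonality of the increments. -/

section ChainEstimates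

variable {d : ℕ} {β : Type*} [Finite β] [MeasurableSpace β] [MeasurableSingletonClass β]
  {Ω : Type*} [MeasurableSpace Ω] {P : Measure Ω} {w : β → ℝ}
  {θ₀ : Ω → Param d} {B : ℕ → Ω → β} {Z : ℕ → Ω → Param d}
  {W ψ F : Param d → ℝ} {v : β → Param d → Param d} {A κ a q : ℝ}

namespace GrowthBounds

variable (hW : GrowthBounds W ψ F v A κ a q) (hN : IsDrivingNoise P w θ₀ B Z)

include hW hN

theorem measurable_chain (h : ℝ) (t : ℕ) : Measurable (chain v θ₀ B Z h t) := by
  induction t with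
  | zero => exact hN.measurable_init
  | succ t ih =>
    exact (hW.measurable_step h).comp
      (ih.prodMk ((hN.measurable_batch t).prodMk (hN.measurable_noise t)))

variable [IsProbabilityMeasure P]

theorem indepFun_chain_input (h : ℝ) (t : ℕ) :
    IndepFun (chain v θ₀ B Z h t) (fun ω => (B t ω, Z t ω)) P :=
  indepFun_state_input hN.measurable_init
    (fun t => (hN.measurable_batch t).prodMk (hN.measurable_noise t)) hN.indep_time hN.indep_init
    measurable_id (hW.measurable_step h) (fun _ => rfl) (fun _ _ => rfl) t

theorem map_chain_input (h : ℝ) (t : ℕ) :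
    P.map (fun ω => (chain v θ₀ B Z h t ω, (B t ω, Z t ω)))
      = (P.map (chain v θ₀ B Z h t)).prod ((P.map (B 0)).prod (stdGaussian (Param d))) := by
  rw [(indepFun_iff_map_prod_eq_prod_map_map (hW.measurable_chain hN h t).aemeasurable
    ((hN.measurable_batch t).prodMk (hN.measurable_noise t)).aemeasurable).1
    (hW.indepFun_chain_input hN h t), hN.map_input]

/-- The centred increments of `ψ` along the chain and the bias of its steps in mean square. -/
theorem chain_mean_square {h K : ℝ} (h0 : 0 < h) (h1 : h ≤ 1)
    (hmom : ∀ t, Integrable (fun ω => W (chain v θ₀ B Z h t ω) ^ (2 * a + 4 * q)) P ∧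
      ∫ ω, W (chain v θ₀ B Z h t ω) ^ (2 * a + 4 * q) ∂P ≤ K) (t : ℕ) :
    (∀ᵐ θ ∂(P.map (chain v θ₀ B Z h t)), Integrable (fun ξ => ψ (step v h θ ξ))
      ((P.map (B 0)).prod (stdGaussian (Param d)))) ∧
    MemLp (fun ω => ψ (chain v θ₀ B Z h (t + 1) ω)
      - stepMean ψ v h ((P.map (B 0)).prod (stdGaussian (Param d))) (chain v θ₀ B Z h t ω)) 2 P ∧
    ∫ ω, (ψ (chain v θ₀ B Z h (t + 1) ω)
      - stepMean ψ v h ((P.map (B 0)).prod (stdGaussian (Param d))) (chain v θ₀ B Z h t ω)) ^ 2 ∂P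
      ≤ 4 * (3 * A ^ 3 * (κ ^ 2) ^ a) ^ 2 * h
        * (2 * (∫ z : Param d, ‖z‖ ^ (2 * ((a + 2 * q) / q)) ∂(stdGaussian (Param d)) + 3 * K)) ∧
    MemLp (fun ω => stepMean ψ v h ((P.map (B 0)).prod (stdGaussian (Param d)))
        (chain v θ₀ B Z h t ω) - ψ (chain v θ₀ B Z h t ω)
      - h / 2 * (fderiv ℝ ψ (chain v θ₀ B Z h t ω) (∫ b, v b (chain v θ₀ B Z h t ω) ∂(P.map (B 0)))
        + F (chain v θ₀ B Z h t ω))) 2 P ∧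
    ∫ ω, (stepMean ψ v h ((P.map (B 0)).prod (stdGaussian (Param d)))
        (chain v θ₀ B Z h t ω) - ψ (chain v θ₀ B Z h t ω)
      - h / 2 * (fderiv ℝ ψ (chain v θ₀ B Z h t ω) (∫ b, v b (chain v θ₀ B Z h t ω) ∂(P.map (B 0)))
        + F (chain v θ₀ B Z h t ω))) ^ 2 ∂P
      ≤ (3 * A ^ 3 * (κ ^ 2) ^ a) ^ 2 * h ^ 4
        * (2 * (∫ z : Param d, ‖z‖ ^ (2 * ((a + 2 * q) / q)) ∂(stdGaussian (Param d)) + 3 * K)) := by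
  have hcm := hW.measurable_chain hN h t
  have hξm : Measurable fun ω => (B t ω, Z t ω) :=
    (hN.measurable_batch t).prodMk (hN.measurable_noise t)
  have hπ := Measure.isProbabilityMeasure_map (μ := P) (hN.measurable_batch 0).aemeasurable
  have hν := Measure.isProbabilityMeasure_map (μ := P) hcm.aemeasurable
  have hmap := hW.map_chain_input hN h t
  have hpm : Measurable fun ω => (chain v θ₀ B Z h t ω, (B t ω, Z t ω)) := hcm.prodMk hξm
  have hWm : Measurable fun θ => W θ ^ (2 * a + 4 * q) := hW.measurable.pow_const _
  have hWs : Measurable fun p : Param d × (β × Param d) =>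
      W (step v h p.1 p.2) ^ (2 * a + 4 * q) := hWm.comp (hW.measurable_step h)
  have hD := hW.integrable_sq_dominator (π := P.map (B 0)) (ν := P.map (chain v θ₀ B Z h t))
    (h := h) (K := K)
    ((integrable_map_measure hWm.aestronglyMeasurable hcm.aemeasurable).2 (hmom t).1)
    (by rw [integral_map hcm.aemeasurable hWm.aestronglyMeasurable]; exact (hmom t).2)
    -- The step from the product law of state and input has the law of the state at time `t + 1`, so
    -- its moment bound is the assumed one at `t + 1`.
    (by
      rw [← hmap]
      exact (integrable_map_measure hWs.aestronglyMeasurable hpm.aemeasurable).2 (hmom (t + 1)).1)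
    (by
      rw [← hmap, integral_map hpm.aemeasurable hWs.aestronglyMeasurable]
      exact (hmom (t + 1)).2)
  obtain ⟨k1, k2, k3, k4, k5⟩ := hW.step_mean_square h0 h1 hD.1 hD.2
  rw [← hmap] at k2 k3
  rw [integral_map hpm.aemeasurable k2.integrable_sq.1] at k3
  rw [integral_map hcm.aemeasurable k4.integrable_sq.1] at k5
  exact ⟨k1, (memLp_map_measure_iff k2.1 hpm.aemeasurable).1 k2, k3,
    (memLp_map_measure_iff k4.1 hcm.aemeasurable).1 k4, k5⟩

/-- The centred increments of `ψ` are orthogonal, so that the second moment of their sum grows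
linearly. -/
theorem martingale_mean_square {h K : ℝ} (h0 : 0 < h) (h1 : h ≤ 1)
    (hmom : ∀ t, Integrable (fun ω => W (chain v θ₀ B Z h t ω) ^ (2 * a + 4 * q)) P ∧
      ∫ ω, W (chain v θ₀ B Z h t ω) ^ (2 * a + 4 * q) ∂P ≤ K) (n : ℕ) :
    MemLp (fun ω => ∑ t ∈ Finset.range n, (ψ (chain v θ₀ B Z h (t + 1) ω)
      - stepMean ψ v h ((P.map (B 0)).prod (stdGaussian (Param d))) (chain v θ₀ B Z h t ω))) 2 P ∧
    ∫ ω, (∑ t ∈ Finset.range n, (ψ (chain v θ₀ B Z h (t + 1) ω)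
      - stepMean ψ v h ((P.map (B 0)).prod (stdGaussian (Param d)))
        (chain v θ₀ B Z h t ω))) ^ 2 ∂P
      ≤ n * (4 * (3 * A ^ 3 * (κ ^ 2) ^ a) ^ 2 * h
        * (2 * (∫ z : Param d, ‖z‖ ^ (2 * ((a + 2 * q) / q)) ∂(stdGaussian (Param d))
          + 3 * K))) := by
  set lam := (P.map (B 0)).prod (stdGaussian (Param d)) with hlam
  have hπ := Measure.isProbabilityMeasure_map (μ := P) (hN.measurable_batch 0).aemeasurable
  have hinc := fun t => (hW.chain_mean_square hN h0 h1 hmom t)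
  set V := 4 * (3 * A ^ 3 * (κ ^ 2) ^ a) ^ 2 * h
        * (2 * (∫ z : Param d, ‖z‖ ^ (2 * ((a + 2 * q) / q)) ∂(stdGaussian (Param d)) + 3 * K))
  set M : ℕ → Ω → ℝ := fun t ω => ψ (chain v θ₀ B Z h (t + 1) ω)
      - stepMean ψ v h lam (chain v θ₀ B Z h t ω) with hM
  have hML : ∀ t, MemLp (M t) 2 P := fun t => (hinc t).2.1
  have hmeanm : Measurable (stepMean ψ v h lam) :=
    (StronglyMeasurable.integral_prod_right' (ν := lam)
      (f := fun p : Param d × (β × Param d) => ψ (step v h p.1 p.2))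
      (hW.sol_contDiff.continuous.measurable.comp
        (hW.measurable_step h)).stronglyMeasurable).measurable
  have hψs : Measurable fun p : Param d × (β × Param d) => ψ (step v h p.1 p.2) :=
    hW.sol_contDiff.continuous.measurable.comp (hW.measurable_step h)
  induction n with
  | zero => simp
  | succ n ih =>
    obtain ⟨hSL, hSK⟩ := ih
    change MemLp (fun ω => ∑ t ∈ Finset.range n, M t ω) 2 P at hSL
    change ∫ ω, (∑ t ∈ Finset.range n, M t ω) ^ 2 ∂P ≤ n * V at hSK
    change MemLp (fun ω => ∑ t ∈ Finset.range (n + 1), M t ω) 2 P ∧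
      ∫ ω, (∑ t ∈ Finset.range (n + 1), M t ω) ^ 2 ∂P ≤ (n + 1 : ℕ) * V
    simp_rw [Finset.sum_range_succ]
    refine ⟨hSL.add (hML n), ?_⟩
    have hSM : Integrable (fun ω => (∑ t ∈ Finset.range n, M t ω) * M n ω) P :=
      hSL.integrable_mul (hML n)
    have horth : ∫ ω, (∑ t ∈ Finset.range n, M t ω) * M n ω ∂P = 0 := by
      -- The state is enlarged by the partial sum. The pair still obeys a recursion driven by the
      -- inputs, so it is independent of the next input, and no conditional expectations are needed.
      let X : ℕ → Ω → Param d × ℝ := fun t ω =>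
        (chain v θ₀ B Z h t ω, ∑ s ∈ Finset.range t, M s ω)
      have hXm : Measurable (X n) :=
        (hW.measurable_chain hN h n).prodMk (Finset.measurable_sum _ fun s _ =>
          (hW.sol_contDiff.continuous.measurable.comp (hW.measurable_chain hN h (s + 1))).sub
            (hmeanm.comp (hW.measurable_chain hN h s)))
      have hξm : Measurable fun ω => (B n ω, Z n ω) :=
        (hN.measurable_batch n).prodMk (hN.measurable_noise n)
      have hXξ : IndepFun (X n) (fun ω => (B n ω, Z n ω)) P := by
        refine indepFun_state_input (ξ := fun t ω => (B t ω, Z t ω)) (X := X)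
          (i := fun θ => (θ, 0))
          (u := fun x => (step v h x.1.1 x.2,
            x.1.2 + (ψ (step v h x.1.1 x.2) - stepMean ψ v h lam x.1.1))) hN.measurable_init
          (fun t => (hN.measurable_batch t).prodMk (hN.measurable_noise t)) hN.indep_time
          hN.indep_init (by fun_prop) ?_ (fun ω => by simp [X, chain]) (fun t ω => ?_) n
        · have hq' : Measurable fun x : (Param d × ℝ) × (β × Param d) => (x.1.1, x.2) := by fun_prop
          exact ((hW.measurable_step h).comp hq').prodMk
            ((measurable_snd.comp measurable_fst).add
              ((hψs.comp hq').sub (hmeanm.comp (measurable_fst.comp measurable_fst))))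
        · simp only [X, Finset.sum_range_succ]
          rfl
      have hmap : P.map (fun ω => (X n ω, (B n ω, Z n ω))) = (P.map (X n)).prod lam := by
        rw [(indepFun_iff_map_prod_eq_prod_map_map hXm.aemeasurable hξm.aemeasurable).1 hXξ,
          hN.map_input]
      have := Measure.isProbabilityMeasure_map (μ := P) hXm.aemeasurable
      let G : (Param d × ℝ) × (β × Param d) → ℝ := fun x =>
        x.1.2 * (ψ (step v h x.1.1 x.2) - stepMean ψ v h lam x.1.1)
      have hGm : Measurable G := by
        have hq' : Measurable fun x : (Param d × ℝ) × (β × Param d) => (x.1.1, x.2) := by fun_prop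
        exact (measurable_snd.comp measurable_fst).mul
              ((hψs.comp hq').sub (hmeanm.comp (measurable_fst.comp measurable_fst)))
      have hpm : Measurable fun ω => (X n ω, (B n ω, Z n ω)) := hXm.prodMk hξm
      have hGi : Integrable G ((P.map (X n)).prod lam) := by
        rw [← hmap]
        exact (integrable_map_measure hGm.aestronglyMeasurable hpm.aemeasurable).2 hSM
      have e : ∫ ω, (∑ t ∈ Finset.range n, M t ω) * M n ω ∂P
          = ∫ x, G x ∂((P.map (X n)).prod lam) := by
        rw [← hmap, integral_map hpm.aemeasurable hGm.aestronglyMeasurable]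
        rfl
      rw [e, integral_prod _ hGi]
      have hae : ∀ᵐ x ∂(P.map (X n)), Integrable (fun ξ => ψ (step v h x.1 ξ)) lam := by
        have h2 := (hinc n).1
        have h3 : P.map (chain v θ₀ B Z h n) = (P.map (X n)).map Prod.fst := by
          rw [Measure.map_map measurable_fst hXm]; rfl
        rw [h3] at h2
        exact ae_of_ae_map measurable_fst.aemeasurable h2
      -- For a fixed past the inner integral is the partial sum times the mean of a centred
      -- increment.
      rw [integral_eq_zero_of_ae]
      filter_upwards [hae] with x hx
      simp only [G, Pi.zero_apply]
      rw [integral_const_mul, integral_sub hx (integrable_const _)]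
      simp [stepMean]
    have hexp : ∀ ω, (∑ t ∈ Finset.range n, M t ω + M n ω) ^ 2
        = (∑ t ∈ Finset.range n, M t ω) ^ 2
          + (2 * ((∑ t ∈ Finset.range n, M t ω) * M n ω) + M n ω ^ 2) := fun ω => by ring
    have hi2 : Integrable (fun ω => 2 * ((∑ t ∈ Finset.range n, M t ω) * M n ω) + M n ω ^ 2) P :=
      (hSM.const_mul 2).add (hML n).integrable_sq
    simp_rw [hexp]
    rw [integral_add hSL.integrable_sq hi2, integral_add (hSM.const_mul 2) (hML n).integrable_sq,
      integral_const_mul, horth]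
    have := (hinc n).2.2.1
    change ∫ ω, M n ω ^ 2 ∂P ≤ V at this
    push_cast
    linarith

end GrowthBounds

end ChainEstimates

/-- The growth $W^{a+2q}$ has a square within the controlled moments, so $\mathcal L\psi$ has a
second moment along the chain that is uniform in time and step size. -/
theorem GrowthBounds.abs_generator_le {d : ℕ} {β : Type*} [MeasurableSpace β]
    {W ψ F : Param d → ℝ} {v : β → Param d → Param d} {A κ a q : ℝ}
    (hW : GrowthBounds W ψ F v A κ a q) {π : Measure β} [IsProbabilityMeasure π] (θ : Param d) :
    |1 / 2 * (fderiv ℝ ψ θ (∫ b, v b θ ∂π) + F θ)| ≤ A ^ 2 * W θ ^ (a + 2 * q) := by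
  have hA := hW.one_le_A
  have h1 := hW.one_le θ
  have hq := hW.q_pos
  have hv : ‖∫ b, v b θ ∂π‖ ≤ A * W θ ^ q := by
    simpa using norm_integral_le_of_norm_le_const (μ := π) (ae_of_all _ fun b => hW.drift_le b θ)
  have hWa : 0 ≤ W θ ^ a := Real.rpow_nonneg (by linarith) _
  have hf : ‖fderiv ℝ ψ θ (∫ b, v b θ ∂π)‖ ≤ A * W θ ^ a * (A * W θ ^ q) :=
    ((fderiv ℝ ψ θ).le_opNorm _).trans (mul_le_mul (hW.fderiv_sol_le θ) hv (norm_nonneg _)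
      (by positivity))
  have e : W θ ^ a * W θ ^ q ≤ W θ ^ (a + 2 * q) := by
    rw [← Real.rpow_add (by linarith)]
    exact Real.rpow_le_rpow_of_exponent_le h1 (by linarith)
  have e' : W θ ^ a ≤ W θ ^ (a + 2 * q) := Real.rpow_le_rpow_of_exponent_le h1 (by linarith)
  have h2 : A * W θ ^ a * (A * W θ ^ q) ≤ A ^ 2 * W θ ^ (a + 2 * q) := by
    calc _ = A ^ 2 * (W θ ^ a * W θ ^ q) := by ring
      _ ≤ _ := by gcongr
  have h3 : A * W θ ^ a ≤ A ^ 2 * W θ ^ (a + 2 * q) := by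
    calc _ ≤ A ^ 2 * W θ ^ a := by gcongr; nlinarith
      _ ≤ _ := by gcongr
  have h4 := hW.lap_le θ
  rw [Real.norm_eq_abs] at hf
  rw [abs_le] at hf h4 ⊢
  constructor <;> linarith [hf.1, hf.2, h4.1, h4.2]

/-! ### Mean square of the time average of the generator. -/

section MeanSquareAverage

variable {d : ℕ} {β : Type*} [Finite β] [MeasurableSpace β] [MeasurableSingletonClass β]
  {Ω : Type*} [MeasurableSpace Ω] {P : Measure Ω} {w : β → ℝ}
  {θ₀ : Ω → Param d} {B : ℕ → Ω → β} {Z : ℕ → Ω → Param d}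
  {W ψ F : Param d → ℝ} {v : β → Param d → Param d} {A κ a q : ℝ}

namespace GrowthBounds

variable (hW : GrowthBounds W ψ F v A κ a q) (hN : IsDrivingNoise P w θ₀ B Z)

include hW hN

theorem memLp_comp_chain {h K L : ℝ} {g : Param d → ℝ} (hg : Measurable g)
    (hgL : ∀ θ, |g θ| ≤ L * W θ ^ (a + 2 * q)) {t : ℕ}
    (hmom : Integrable (fun ω => W (chain v θ₀ B Z h t ω) ^ (2 * a + 4 * q)) P ∧
      ∫ ω, W (chain v θ₀ B Z h t ω) ^ (2 * a + 4 * q) ∂P ≤ K) :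
    MemLp (fun ω => g (chain v θ₀ B Z h t ω)) 2 P ∧
      ∫ ω, g (chain v θ₀ B Z h t ω) ^ 2 ∂P ≤ L ^ 2 * K := by
  have hm : Measurable fun ω => g (chain v θ₀ B Z h t ω) := hg.comp (hW.measurable_chain hN h t)
  have hle : ∀ θ, g θ ^ 2 ≤ L ^ 2 * W θ ^ (2 * a + 4 * q) := by
    intro θ
    have h0 : 0 ≤ W θ := zero_le_one.trans (hW.one_le θ)
    have e : W θ ^ (2 * a + 4 * q) = (W θ ^ (a + 2 * q)) ^ 2 := by
      rw [← Real.rpow_mul_natCast h0]; congr 1; push_cast; ring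
    rw [e, ← mul_pow, ← sq_abs]
    exact pow_le_pow_left₀ (abs_nonneg _) (hgL θ) 2
  have hi : Integrable (fun ω => g (chain v θ₀ B Z h t ω) ^ 2) P :=
    (hmom.1.const_mul (L ^ 2)).mono' (hm.pow_const 2).aestronglyMeasurable
      (ae_of_all _ fun ω => by rw [Real.norm_of_nonneg (sq_nonneg _)]; exact hle _)
  refine ⟨(memLp_two_iff_integrable_sq hm.aestronglyMeasurable).2 hi,
    (integral_mono hi (hmom.1.const_mul (L ^ 2)) fun ω => hle _).trans ?_⟩
  rw [integral_const_mul]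
  exact mul_le_mul_of_nonneg_left hmom.2 (sq_nonneg _)

variable [IsProbabilityMeasure P]

/-- The mean square error of the time average of `ℒψ` along the chain. -/
theorem exists_mean_square_average_le {H : Set ℝ} (hH : ∀ h ∈ H, 0 < h) {K : ℝ}
    (hmom : ∀ h ∈ H, ∀ t, Integrable (fun ω => W (chain v θ₀ B Z h t ω) ^ (2 * a + 4 * q)) P ∧
      ∫ ω, W (chain v θ₀ B Z h t ω) ^ (2 * a + 4 * q) ∂P ≤ K) {g : Param d → ℝ}
    (hg : ∀ θ, g θ = 1 / 2 * (fderiv ℝ ψ θ (∫ b, v b θ ∂(P.map (B 0))) + F θ)) :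
    ∃ C : ℝ, 0 < C ∧ ∀ h ∈ H, ∀ T : ℕ, 0 < T →
      Integrable (fun ω => sampleAverage g (chain v θ₀ B Z h) T ω ^ 2) P ∧
      ∫ ω, sampleAverage g (chain v θ₀ B Z h) T ω ^ 2 ∂P ≤ C * (1 / (h * T) + h ^ 2) := by
  have hπ := Measure.isProbabilityMeasure_map (μ := P) (hN.measurable_batch 0).aemeasurable
  have hA := hW.one_le_A
  have hq := hW.q_pos
  have hκ := hW.one_le_rpow_κ
  set lam := (P.map (B 0)).prod (stdGaussian (Param d))
  set J := ∫ z : Param d, ‖z‖ ^ (2 * ((a + 2 * q) / q)) ∂(stdGaussian (Param d))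
  have hJ : 0 ≤ J := integral_nonneg fun z => Real.rpow_nonneg (norm_nonneg _) _
  rcases H.eq_empty_or_nonempty with rfl | ⟨h₀, hh₀⟩
  · exact ⟨1, one_pos, by simp⟩
  have hK : 0 ≤ K := (integral_nonneg fun ω =>
    Real.rpow_nonneg (zero_le_one.trans (hW.one_le _)) _).trans (hmom h₀ hh₀ 0).2
  set c := (3 * A ^ 3 * (κ ^ 2) ^ a) ^ 2 * (2 * (J + 3 * K)) with hc
  have hc0 : 0 ≤ c := by positivity
  -- The first summand serves the regime where the right-hand side is at least `C`, the second the
  -- expansion below; the 1 makes `C` positive.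
  set C := (A ^ 2) ^ 2 * K + 5 * (2 * (A ^ 2 * K) + 13 * c) + 1 with hCdef
  have hC0 : 0 < C := by positivity
  have hgm : Measurable g := by
    rw [funext hg]; exact (hW.measurable_generator _).const_mul _
  have hgL : ∀ θ, |g θ| ≤ A ^ 2 * W θ ^ (a + 2 * q) := fun θ => by
    rw [hg]; exact hW.abs_generator_le θ
  have hψL : ∀ θ, |ψ θ| ≤ A * W θ ^ (a + 2 * q) := fun θ =>
    (hW.sol_le θ).trans (mul_le_mul_of_nonneg_left
      (Real.rpow_le_rpow_of_exponent_le (hW.one_le θ) (by linarith)) (by linarith))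
  refine ⟨C, hC0, fun h hh T hT => ?_⟩
  have h0 := hH h hh
  have hT0 : (0 : ℝ) < T := Nat.cast_pos.2 hT
  have hT1 : (1 : ℝ) ≤ T := Nat.one_le_cast.2 hT
  have hhT : 0 < h * T := mul_pos h0 hT0
  have hgt := fun t => hW.memLp_comp_chain hN hgm hgL (hmom h hh t)
  have hsum : MemLp (fun ω => ∑ t ∈ Finset.Icc 1 T, g (chain v θ₀ B Z h t ω)) 2 P :=
    memLp_finsetSum _ fun t _ => (hgt t).1
  have havg : MemLp (fun ω => sampleAverage g (chain v θ₀ B Z h) T ω) 2 P := hsum.const_mul _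
  refine ⟨havg.integrable_sq, ?_⟩
  have hsq : ∫ ω, sampleAverage g (chain v θ₀ B Z h) T ω ^ 2 ∂P
      = ((T : ℝ) ^ 2)⁻¹ * ∫ ω, (∑ t ∈ Finset.Icc 1 T, g (chain v θ₀ B Z h t ω)) ^ 2 ∂P := by
    rw [← integral_const_mul]
    simp only [sampleAverage, mul_pow, inv_pow]
  by_cases hlarge : 1 ≤ 1 / (h * T) + h ^ 2
  · calc _ ≤ (A ^ 2) ^ 2 * K := by
          rw [hsq, inv_mul_le_iff₀ (by positivity)]
          simpa using integral_sq_sum_le (Finset.Icc 1 T) (fun t _ => (hgt t).1)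
            (fun t _ => (hgt t).2)
      _ ≤ C := by
          have : 0 ≤ 5 * (2 * (A ^ 2 * K) + 13 * c) := by positivity
          linarith
      _ ≤ _ := le_mul_of_one_le_right hC0.le hlarge
  · push Not at hlarge
    -- In the remaining regime `1 ≤ h * T`, which absorbs the boundary terms, and `h ≤ 1`, which the
    -- one-step estimates need.
    have hhT1 : 1 ≤ h * T := by
      by_contra hcon
      push Not at hcon
      have : 1 < 1 / (h * T) := (one_lt_div hhT).2 hcon
      nlinarith [sq_nonneg h]
    have h1 : h ≤ 1 := by
      by_contra hcon
      push Not at hcon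
      have : 0 < 1 / (h * T) := by positivity
      nlinarith
    have hψt := fun t => hW.memLp_comp_chain hN hW.sol_contDiff.continuous.measurable hψL
      (hmom h hh t)
    have hst := hW.chain_mean_square hN h0 h1 (hmom h hh)
    have hmart := hW.martingale_mean_square hN h0 h1 (hmom h hh)
    set S : ℕ → Ω → ℝ := fun n ω => ∑ t ∈ Finset.range n, (ψ (chain v θ₀ B Z h (t + 1) ω)
      - stepMean ψ v h lam (chain v θ₀ B Z h t ω)) with hS
    set R : ℕ → Ω → ℝ := fun t ω => stepMean ψ v h lam (chain v θ₀ B Z h t ω)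
      - ψ (chain v θ₀ B Z h t ω)
      - h / 2 * (fderiv ℝ ψ (chain v θ₀ B Z h t ω) (∫ b, v b (chain v θ₀ B Z h t ω) ∂(P.map (B 0)))
        + F (chain v θ₀ B Z h t ω)) with hR
    have hSL : ∀ n, MemLp (S n) 2 P := fun n => (hmart n).1
    have hSK : ∀ n, ∫ ω, S n ω ^ 2 ∂P ≤ n * (4 * h * c) := fun n =>
      (hmart n).2.trans_eq (by rw [hc]; ring)
    have hRL : ∀ t, MemLp (R t) 2 P := fun t => (hst t).2.2.2.1
    have hRK : ∀ t, ∫ ω, R t ω ^ 2 ∂P ≤ h ^ 4 * c := fun t =>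
      (hst t).2.2.2.2.trans_eq (by rw [hc]; ring)
    -- Telescoping. The average starts at `t = 1`, so the step from time 0 is removed: the boundary
    -- term is taken at time 1 and `S 1` is subtracted.
    have hdec : ∀ ω, h * ∑ t ∈ Finset.Icc 1 T, g (chain v θ₀ B Z h t ω)
        = ψ (chain v θ₀ B Z h (T + 1) ω) - ψ (chain v θ₀ B Z h 1 ω) - (S (T + 1) ω - S 1 ω)
          - ∑ t ∈ Finset.Icc 1 T, R t ω := by
      intro ω
      clear_value C c
      clear hT hT0 hT1 hhT hsum havg hsq hlarge hhT1
      induction T with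
      | zero => simp
      | succ n ih =>
        rw [Finset.sum_Icc_succ_top (by omega), Finset.sum_Icc_succ_top (by omega), mul_add, ih]
        have : S (n + 1 + 1) ω = S (n + 1) ω + (ψ (chain v θ₀ B Z h (n + 1 + 1) ω)
            - stepMean ψ v h lam (chain v θ₀ B Z h (n + 1) ω)) := Finset.sum_range_succ _ _
        rw [this, hg]
        simp only [hR]
        ring
    have hRs : MemLp (fun ω => ∑ t ∈ Finset.Icc 1 T, R t ω) 2 P :=
      memLp_finsetSum _ fun t _ => hRL t
    have hRsK : ∫ ω, (∑ t ∈ Finset.Icc 1 T, R t ω) ^ 2 ∂P ≤ (T : ℝ) ^ 2 * (h ^ 4 * c) := by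
      simpa using integral_sq_sum_le (Finset.Icc 1 T) (fun t _ => hRL t) (fun t _ => hRK t)
    have hfive : h ^ 2 * ∫ ω, (∑ t ∈ Finset.Icc 1 T, g (chain v θ₀ B Z h t ω)) ^ 2 ∂P
        ≤ 5 * (A ^ 2 * K + (A ^ 2 * K + ((T + 1 : ℕ) * (4 * h * c) + ((1 : ℕ) * (4 * h * c)
          + (T : ℝ) ^ 2 * (h ^ 4 * c))))) := by
      have i1 := (hψt (T + 1)).1.integrable_sq
      have i2 := (hψt 1).1.integrable_sq
      have i3 := (hSL (T + 1)).integrable_sq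
      have i4 := (hSL 1).integrable_sq
      have i5 := hRs.integrable_sq
      have i45 : Integrable (fun ω => S 1 ω ^ 2 + (∑ t ∈ Finset.Icc 1 T, R t ω) ^ 2) P := i4.add i5
      have i345 : Integrable (fun ω => S (T + 1) ω ^ 2
        + (S 1 ω ^ 2 + (∑ t ∈ Finset.Icc 1 T, R t ω) ^ 2)) P := i3.add i45
      have i2345 : Integrable (fun ω => ψ (chain v θ₀ B Z h 1 ω) ^ 2 + (S (T + 1) ω ^ 2
        + (S 1 ω ^ 2 + (∑ t ∈ Finset.Icc 1 T, R t ω) ^ 2))) P := i2.add i345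
      have iall : Integrable (fun ω => ψ (chain v θ₀ B Z h (T + 1) ω) ^ 2
        + (ψ (chain v θ₀ B Z h 1 ω) ^ 2 + (S (T + 1) ω ^ 2
        + (S 1 ω ^ 2 + (∑ t ∈ Finset.Icc 1 T, R t ω) ^ 2)))) P := i1.add i2345
      rw [← integral_const_mul]
      refine (integral_mono (hsum.integrable_sq.const_mul _) (iall.const_mul 5)
        fun ω => ?_).trans ?_
      · beta_reduce
        rw [← mul_pow, hdec]
        generalize ψ (chain v θ₀ B Z h (T + 1) ω) = x₁
        generalize ψ (chain v θ₀ B Z h 1 ω) = x₂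
        generalize S (T + 1) ω = x₃
        generalize S 1 ω = x₄
        generalize ∑ t ∈ Finset.Icc 1 T, R t ω = x₅
        -- Cauchy–Schwarz for five terms; the ten squares are the pairwise defects.
        nlinarith [sq_nonneg (x₁ + x₂), sq_nonneg (x₁ + x₃), sq_nonneg (x₁ - x₄),
          sq_nonneg (x₁ + x₅), sq_nonneg (x₂ - x₃), sq_nonneg (x₂ + x₄), sq_nonneg (x₂ - x₅),
          sq_nonneg (x₃ + x₄), sq_nonneg (x₃ - x₅), sq_nonneg (x₄ + x₅)]
      · rw [integral_const_mul, integral_add i1 i2345, integral_add i2 i345, integral_add i3 i45,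
          integral_add i4 i5]
        exact mul_le_mul_of_nonneg_left (add_le_add (hψt _).2 (add_le_add (hψt _).2
          (add_le_add (hSK _) (add_le_add (hSK _) hRsK)))) (by norm_num)
    rw [hsq, inv_mul_le_iff₀ (by positivity), ← mul_le_mul_iff_of_pos_left (a := h ^ 2) (by positivity)]
    refine hfive.trans ?_
    have e : h ^ 2 * ((T : ℝ) ^ 2 * (C * (1 / (h * T) + h ^ 2)))
        = C * (h * T) + C * ((T : ℝ) ^ 2 * h ^ 4) := by
      field_simp
    rw [e]
    push_cast
    have hTh : 0 ≤ (T : ℝ) ^ 2 * h ^ 4 := by positivity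
    have hAK : 0 ≤ A ^ 2 * K := by positivity
    have hAK' : 0 ≤ (A ^ 2) ^ 2 * K := by positivity
    have hC1 : 5 * (2 * (A ^ 2 * K) + 12 * c) ≤ C := by linarith
    have hC2 : 5 * c ≤ C := by linarith
    -- The 12 collects $4(T+1)hc+4hc\le 12c\,hT$, using $T\ge1$.
    have b1 : 5 * (2 * (A ^ 2 * K) + 12 * c) * (h * T) ≤ C * (h * T) :=
      mul_le_mul_of_nonneg_right hC1 hhT.le
    have b2 : 5 * c * ((T : ℝ) ^ 2 * h ^ 4) ≤ C * ((T : ℝ) ^ 2 * h ^ 4) :=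
      mul_le_mul_of_nonneg_right hC2 hTh
    have b3 : A ^ 2 * K ≤ A ^ 2 * K * (h * T) := le_mul_of_one_le_right hAK hhT1
    have b4 : h * c ≤ c * (h * T) := by nlinarith [mul_nonneg h0.le hc0]
    linarith

end GrowthBounds

end MeanSquareAverage

/-- Mini-batches range over a sigma type, or functions into one, and their law is determined by its
values on singletons. -/
instance instMeasurableSingletonClassSigma {ι : Type*} {α : ι → Type*}
    [∀ i, MeasurableSpace (α i)] [∀ i, DiscreteMeasurableSpace (α i)] :
    MeasurableSingletonClass (Sigma α) where
  measurableSet_singleton x := by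
    rw [MeasurableSpace.measurableSet_iInf]
    intro i
    exact (MeasurableSet.of_discrete : MeasurableSet (Sigma.mk i ⁻¹' {x}))

/-- The average over all samples with replacement of the sum over a sample. -/
theorem sum_sample_sum_eq {ι E : Type*} [Fintype ι] [Nonempty ι] [AddCommGroup E] [Module ℝ E]
    (m : ℕ) (g : ι → E) :
    ∑ b : Fin m → ι, (1 / (Fintype.card ι : ℝ)) ^ m • ∑ j, g (b j)
      = ((m : ℝ) / Fintype.card ι) • ∑ i, g i := by
  have hc : (Fintype.card ι : ℝ) ≠ 0 := Nat.cast_ne_zero.2 Fintype.card_ne_zero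
  have hj : ∀ j : Fin m, (1 / (Fintype.card ι : ℝ)) ^ m • ∑ b : Fin m → ι, g (b j)
      = (1 / (Fintype.card ι : ℝ)) • ∑ i, g i := by
    intro j
    cases m with
    | zero => exact j.elim0
    | succ n =>
      -- The `j`-th draw is split off; the sum over the other draws is a pure count, cancelled by
      -- all but one factor of the weight.
      rw [← (Fin.insertNthEquiv (fun _ => ι) j).sum_comp, Fintype.sum_prod_type]
      simp only [Fin.insertNthEquiv_apply, Fin.insertNth_apply_same, Finset.sum_const,
        Finset.card_univ, Fintype.card_pi, Finset.prod_const, Fintype.card_fin]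
      rw [← Finset.smul_sum, ← Nat.cast_smul_eq_nsmul ℝ, smul_smul]
      congr 1
      push_cast
      rw [pow_succ, mul_right_comm, ← mul_pow, one_div_mul_cancel hc, one_pow, one_mul]
  rw [← Finset.smul_sum, Finset.sum_comm, Finset.smul_sum, Finset.sum_congr rfl fun j _ => hj j,
    Finset.sum_const, Finset.card_univ, Fintype.card_fin, ← Nat.cast_smul_eq_nsmul ℝ, smul_smul]
  congr 1
  ring

/-! ### The log-posterior and the unbiasedness of the gradient estimators. -/

section ModelFacts

variable {d S : ℕ} {𝒳 : Type*}

namespace Model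

variable {M : Model d S 𝒳}

theorem IsRegular.integral_unnormalized_pos (hM : M.IsRegular) : 0 < ∫ θ, M.unnormalized θ := by
  have hpos : ∀ θ, 0 < M.unnormalized θ := fun θ =>
    mul_pos (hM.prior_pos θ) (Finset.prod_pos fun s _ => Finset.prod_pos fun i _ => hM.lik_pos s i θ)
  rw [integral_pos_iff_support_of_nonneg (fun θ => (hpos θ).le) hM.proper]
  have : Function.support M.unnormalized = Set.univ :=
    Set.eq_univ_of_forall fun θ => (hpos θ).ne'
  rw [this]
  exact Measure.measure_univ_pos.2 (NeZero.ne _)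

/-- The normalising integral enters as an additive constant, so it drops out of every derivative. -/
theorem IsRegular.log_posterior (hM : M.IsRegular) (θ : Param d) :
    Real.log (M.posterior θ) = Real.log (M.prior θ)
      + ∑ s, ∑ i, Real.log (M.lik (M.x s i) θ) - Real.log (∫ θ', M.unnormalized θ') := by
  have hp : ∀ s, ∏ i, M.lik (M.x s i) θ ≠ 0 := fun s =>
    Finset.prod_ne_zero_iff.2 fun i _ => (hM.lik_pos s i θ).ne'
  have hpp : ∏ s, ∏ i, M.lik (M.x s i) θ ≠ 0 := Finset.prod_ne_zero_iff.2 fun s _ => hp s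
  have hu : M.unnormalized θ ≠ 0 := mul_ne_zero (hM.prior_pos θ).ne' hpp
  rw [posterior, Real.log_div hu hM.integral_unnormalized_pos.ne', unnormalized, Real.log_mul (hM.prior_pos θ).ne' hpp,
    Real.log_prod fun s _ => hp s]
  congr 2
  exact Finset.sum_congr rfl fun s _ => Real.log_prod fun i _ => (hM.lik_pos s i θ).ne'

theorem IsRegular.contDiff_log_prior (hM : M.IsRegular) :
    ContDiff ℝ 3 fun θ => Real.log (M.prior θ) :=
  hM.prior_contDiff.log fun θ => (hM.prior_pos θ).ne'

theorem IsRegular.contDiff_log_lik (hM : M.IsRegular) (s : Fin S) (i : Fin (M.N s)) :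
    ContDiff ℝ 3 fun θ => Real.log (M.lik (M.x s i) θ) :=
  (hM.lik_contDiff s i).log fun θ => (hM.lik_pos s i θ).ne'

theorem IsRegular.contDiff_log_posterior (hM : M.IsRegular) :
    ContDiff ℝ 3 fun θ => Real.log (M.posterior θ) := by
  simp_rw [hM.log_posterior]
  exact (hM.contDiff_log_prior.add (ContDiff.sum fun s _ => ContDiff.sum fun i _ =>
    hM.contDiff_log_lik s i)).sub contDiff_const

theorem IsRegular.gradient_log_posterior (hM : M.IsRegular) (θ : Param d) :
    ∇ (fun θ' => Real.log (M.posterior θ')) θ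
      = ∇ (fun θ' => Real.log (M.prior θ')) θ + ∑ s, ∑ i, M.gradLogLik (M.x s i) θ := by
  refine HasGradientAt.gradient ?_
  simp_rw [hM.log_posterior]
  rw [hasGradientAt_iff_hasFDerivAt]
  have hp : HasFDerivAt (fun θ' => Real.log (M.prior θ'))
      (InnerProductSpace.toDual ℝ _ (∇ (fun θ' => Real.log (M.prior θ')) θ)) θ := by
    rw [toDual_gradient]
    exact (hM.contDiff_log_prior.differentiable (by norm_num) θ).hasFDerivAt
  have hl : ∀ s i, HasFDerivAt (fun θ' => Real.log (M.lik (M.x s i) θ'))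
      (InnerProductSpace.toDual ℝ _ (M.gradLogLik (M.x s i) θ)) θ := by
    intro s i
    rw [gradLogLik, toDual_gradient]
    exact ((hM.contDiff_log_lik s i).differentiable (by norm_num) θ).hasFDerivAt
  have := (hp.add (HasFDerivAt.fun_sum (u := Finset.univ) fun s _ =>
    HasFDerivAt.fun_sum (u := Finset.univ) fun i _ => hl s i)).sub_const
    (Real.log (∫ θ', M.unnormalized θ'))
  refine this.congr_fderiv ?_
  simp only [map_add, map_sum]

theorem continuous_gradient {f : Param d → ℝ} (hf : ContDiff ℝ 3 f) : Continuous (∇ f) :=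
  (InnerProductSpace.toDual ℝ (Param d)).symm.continuous.comp
    (hf.continuous_fderiv (by norm_num))

theorem IsRegular.continuous_gradLogLik (hM : M.IsRegular) (s : Fin S) (i : Fin (M.N s)) :
    Continuous (M.gradLogLik (M.x s i)) :=
  continuous_gradient (hM.contDiff_log_lik s i)

theorem IsRegular.continuous_dsgldEstimator (hM : M.IsRegular) (f : Fin S → ℝ) (m : ℕ)
    (b : M.ShardBatch m) : Continuous (M.dsgldEstimator f m b) := by
  have hl : ∀ j, Continuous (M.gradLogLik (M.x b.1 (b.2 j))) := fun j =>
    hM.continuous_gradLogLik _ _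
  have hp := continuous_gradient hM.contDiff_log_prior
  unfold dsgldEstimator
  fun_prop

theorem IsRegular.continuous_sgldEstimator (hM : M.IsRegular) (m : ℕ)
    (b : M.MergedBatch m) : Continuous (M.sgldEstimator m b) := by
  have hl : ∀ j, Continuous (M.gradLogLik (M.x (b j).1 (b j).2)) := fun j =>
    hM.continuous_gradLogLik _ _
  have hp := continuous_gradient hM.contDiff_log_prior
  unfold sgldEstimator
  fun_prop

/-- The factor $1/f_s$ cancels the probability of choosing shard $s$, and $N_s/m$ cancels the mean
$m/N_s$ of a uniform sample sum. Each shard thus contributes its full gradient. -/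
theorem IsRegular.sum_dsgldEstimator (hM : M.IsRegular) {f : Fin S → ℝ} (hf_pos : ∀ s, 0 < f s)
    (hf_sum : ∑ s, f s = 1) {m : ℕ} (hm : 0 < m) (θ : Param d) :
    ∑ b, M.shardBatchProb f m b • M.dsgldEstimator f m b θ
      = ∇ (fun θ' => Real.log (M.posterior θ')) θ := by
  have hm0 : (m : ℝ) ≠ 0 := Nat.cast_ne_zero.2 hm.ne'
  rw [hM.gradient_log_posterior, Fintype.sum_sigma]
  have hs : ∀ s, ∑ c : Fin m → Fin (M.N s),
      M.shardBatchProb f m ⟨s, c⟩ • M.dsgldEstimator f m ⟨s, c⟩ θ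
      = f s • ∇ (fun θ' => Real.log (M.prior θ')) θ + ∑ i, M.gradLogLik (M.x s i) θ := by
    intro s
    have hN : (M.N s : ℝ) ≠ 0 := Nat.cast_ne_zero.2 (hM.shard_nonempty s).ne'
    have : Nonempty (Fin (M.N s)) := ⟨⟨0, hM.shard_nonempty s⟩⟩
    have key := sum_sample_sum_eq m fun i => M.gradLogLik (M.x s i) θ
    rw [Fintype.card_fin] at key
    simp only [shardBatchProb, dsgldEstimator, smul_add, Finset.sum_add_distrib]
    congr 1
    · rw [Finset.sum_const, Finset.card_univ, Fintype.card_pi, Finset.prod_const, Finset.card_univ,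
        Fintype.card_fin, Fintype.card_fin, ← Nat.cast_smul_eq_nsmul ℝ, smul_smul]
      congr 1
      push_cast
      rw [mul_left_comm, ← mul_pow, mul_one_div_cancel hN, one_pow, mul_one]
    · have e : ∀ c : Fin m → Fin (M.N s), (f s * (1 / (M.N s : ℝ)) ^ m) •
          ((M.N s : ℝ) / (f s * m)) • ∑ j, M.gradLogLik (M.x s (c j)) θ
          = ((M.N s : ℝ) / m) • (1 / (M.N s : ℝ)) ^ m • ∑ j, M.gradLogLik (M.x s (c j)) θ := by
        intro c
        rw [smul_smul, smul_smul]
        congr 1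
        have := (hf_pos s).ne'
        field_simp
      rw [Finset.sum_congr rfl fun c _ => e c, ← Finset.smul_sum, key, smul_smul,
        div_mul_div_cancel₀ hm0, div_self hN, one_smul]
  rw [Finset.sum_congr rfl fun s _ => hs s, Finset.sum_add_distrib, ← Finset.sum_smul, hf_sum,
    one_smul]

theorem IsRegular.sum_sgldEstimator (hM : M.IsRegular) (hS : 0 < S) {m : ℕ} (hm : 0 < m)
    (θ : Param d) :
    ∑ b, M.mergedBatchProb m b • M.sgldEstimator m b θ
      = ∇ (fun θ' => Real.log (M.posterior θ')) θ := by
  have hm0 : (m : ℝ) ≠ 0 := Nat.cast_ne_zero.2 hm.ne'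
  have : Nonempty ((s : Fin S) × Fin (M.N s)) := ⟨⟨⟨0, hS⟩, ⟨0, hM.shard_nonempty _⟩⟩⟩
  have hcard : Fintype.card ((s : Fin S) × Fin (M.N s)) = M.total := by
    simp [total, Fintype.card_sigma]
  have hN : (M.total : ℝ) ≠ 0 := by
    rw [← hcard]; exact Nat.cast_ne_zero.2 Fintype.card_ne_zero
  have key := sum_sample_sum_eq m
    fun i : (s : Fin S) × Fin (M.N s) => M.gradLogLik (M.x i.1 i.2) θ
  rw [hcard, Fintype.sum_sigma] at key
  rw [hM.gradient_log_posterior]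
  simp only [mergedBatchProb, sgldEstimator, smul_add, Finset.sum_add_distrib]
  congr 1
  · rw [Finset.sum_const, Finset.card_univ, Fintype.card_pi, Finset.prod_const, Finset.card_univ,
      Fintype.card_fin, hcard, ← Nat.cast_smul_eq_nsmul ℝ, smul_smul]
    push_cast
    rw [← mul_pow, mul_one_div_cancel hN, one_pow, one_smul]
  · simp_rw [smul_comm ((1 / (M.total : ℝ)) ^ m) ((M.total : ℝ) / m)]
    rw [← Finset.smul_sum, key, smul_smul, div_mul_div_cancel₀ hm0, div_self hN, one_smul]

/-- The prior gradient cancels and the likelihood gradients are bounded, so the estimator stays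
within a constant of the full gradient and inherits its growth. Batches of pairs (shard, index)
cover both DSGLD and SGLD. -/
theorem norm_prior_add_smul_sum_sub_posterior_le (hM : M.IsRegular) {γ : Fin S → ℝ}
    (hγ : ∀ s i θ, ‖M.gradLogLik (M.x s i) θ‖ ≤ γ s) {m : ℕ} (c : ℝ)
    (b : Fin m → (s : Fin S) × Fin (M.N s)) (θ : Param d) :
    ‖∇ (fun θ' => Real.log (M.prior θ')) θ + c • ∑ j, M.gradLogLik (M.x (b j).1 (b j).2) θ
        - ∇ (fun θ' => Real.log (M.posterior θ')) θ‖
      ≤ |c| * ∑ j, γ (b j).1 + ∑ s, ∑ _i : Fin (M.N s), γ s := by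
  rw [hM.gradient_log_posterior, add_sub_add_left_eq_sub]
  refine (norm_sub_le _ _).trans (add_le_add ?_ ?_)
  · rw [norm_smul, Real.norm_eq_abs]
    exact mul_le_mul_of_nonneg_left (norm_sum_le_of_le _ fun j _ => hγ _ _ θ) (abs_nonneg c)
  · exact norm_sum_le_of_le _ fun s _ => norm_sum_le_of_le _ fun i _ => hγ s i θ

end Model

end ModelFacts

theorem norm_fderiv_fderiv {E F : Type*} [NormedAddCommGroup E] [NormedSpace ℝ E]
    [NormedAddCommGroup F] [NormedSpace ℝ F] (f : E → F) (x : E) :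
    ‖fderiv ℝ (fderiv ℝ f) x‖ = ‖iteratedFDeriv ℝ 2 f x‖ := by
  rw [← norm_iteratedFDeriv_one, norm_iteratedFDeriv_fderiv]

/-! ### Derivative bounds for the Laplacian and for inner products of gradients. -/

section Laplacian

variable {E : Type*} [NormedAddCommGroup E] [InnerProductSpace ℝ E] [FiniteDimensional ℝ E]

theorem abs_laplacian_le (ψ : E → ℝ) (θ : E) :
    |Laplacian.laplacian ψ θ| ≤ Module.finrank ℝ E * ‖iteratedFDeriv ℝ 2 ψ θ‖ := by
  rw [InnerProductSpace.laplacian_eq_iteratedFDeriv_stdOrthonormalBasis]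
  refine (Finset.abs_sum_le_sum_abs _ _).trans ((Finset.sum_le_card_nsmul _ _
    ‖iteratedFDeriv ℝ 2 ψ θ‖ fun i _ => ?_).trans_eq (by simp))
  exact ((iteratedFDeriv ℝ 2 ψ θ).le_opNorm _).trans_eq (by simp)

theorem norm_fderiv_laplacian_le {ψ : E → ℝ} (hψ : ContDiff ℝ 3 ψ) (θ : E) :
    ‖fderiv ℝ (Laplacian.laplacian ψ) θ‖
      ≤ Module.finrank ℝ E * ‖iteratedFDeriv ℝ 3 ψ θ‖ := by
  set b := stdOrthonormalBasis ℝ E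
  have hd : HasFDerivAt (iteratedFDeriv ℝ 2 ψ) (fderiv ℝ (iteratedFDeriv ℝ 2 ψ) θ) θ :=
    (hψ.differentiable_iteratedFDeriv (m := 2) (by norm_num) θ).hasFDerivAt
  have hi : ∀ i, HasFDerivAt (fun u => iteratedFDeriv ℝ 2 ψ u ![b i, b i])
      ((ContinuousMultilinearMap.apply ℝ (fun _ : Fin 2 => E) ℝ ![b i, b i]).comp
        (fderiv ℝ (iteratedFDeriv ℝ 2 ψ) θ)) θ := fun i =>
    (ContinuousMultilinearMap.apply ℝ (fun _ : Fin 2 => E) ℝ ![b i, b i]).hasFDerivAt.comp θ hd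
  have hs := HasFDerivAt.fun_sum (u := Finset.univ) fun i _ => hi i
  rw [InnerProductSpace.laplacian_eq_iteratedFDeriv_stdOrthonormalBasis]
  rw [hs.fderiv]
  refine ContinuousLinearMap.opNorm_le_bound _ (by positivity) fun w => ?_
  have hw : ‖fderiv ℝ (iteratedFDeriv ℝ 2 ψ) θ w‖ ≤ ‖iteratedFDeriv ℝ 3 ψ θ‖ * ‖w‖ := by
    rw [← norm_fderiv_iteratedFDeriv]
    exact ContinuousLinearMap.le_opNorm _ w
  rw [_root_.sum_apply]
  refine (norm_sum_le _ _).trans ((Finset.sum_le_card_nsmul _ _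
    (‖iteratedFDeriv ℝ 3 ψ θ‖ * ‖w‖) fun i _ => ?_).trans_eq ?_)
  · refine ((fderiv ℝ (iteratedFDeriv ℝ 2 ψ) θ w).le_opNorm _).trans (le_trans (le_of_eq ?_) hw)
    simp
  · simp [mul_assoc]

end Laplacian

section Gradient

variable {d : ℕ}

theorem norm_iteratedFDeriv_gradient (f : Param d → ℝ) (x : Param d) (n : ℕ) :
    ‖iteratedFDeriv ℝ n (∇ f) x‖ = ‖iteratedFDeriv ℝ (n + 1) f x‖ := by
  rw [← norm_iteratedFDeriv_fderiv]
  exact (InnerProductSpace.toDual ℝ (Param d)).symm.norm_iteratedFDeriv_comp_left (fderiv ℝ f) x n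

theorem contDiff_gradient {f : Param d → ℝ} (hf : ContDiff ℝ 3 f) : ContDiff ℝ 2 (∇ f) :=
  (InnerProductSpace.toDual ℝ (Param d)).symm.contDiff.comp (hf.fderiv_right (by norm_num))

/-- The Leibniz rule, with binomial weights 1, 2, 1; each gradient raises the order of
differentiation by one. -/
theorem norm_iteratedFDeriv_inner_gradient_le {f g : Param d → ℝ} (hf : ContDiff ℝ 3 f)
    (hg : ContDiff ℝ 3 g) (x : Param d) :
    ‖iteratedFDeriv ℝ 2 (fun y => inner ℝ (∇ f y) (∇ g y)) x‖
      ≤ ‖iteratedFDeriv ℝ 1 f x‖ * ‖iteratedFDeriv ℝ 3 g x‖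
        + 2 * ‖iteratedFDeriv ℝ 2 f x‖ * ‖iteratedFDeriv ℝ 2 g x‖
        + ‖iteratedFDeriv ℝ 3 f x‖ * ‖iteratedFDeriv ℝ 1 g x‖ := by
  have h := (innerSL ℝ (E := Param d)).norm_iteratedFDeriv_le_of_bilinear_of_le_one
    (contDiff_gradient hf) (contDiff_gradient hg) x (n := 2) (by norm_num) (norm_innerSL_le ℝ)
  change ‖iteratedFDeriv ℝ 2 (fun y => innerSL ℝ (∇ f y) (∇ g y)) x‖ ≤ _
  refine h.trans (le_of_eq ?_)
  simp [Finset.sum_range_succ, norm_iteratedFDeriv_gradient, -norm_iteratedFDeriv_zero]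

end Gradient

/-! ### From the growth conditions in `Γ` to the single weight `1 + Γ`. -/

section Growth

variable {d S : ℕ} {𝒳 : Type*} {M : Model d S 𝒳} {φ ψ Γ : Param d → ℝ} {p : Fin 4 → ℝ} {r q : ℝ}

namespace PoissonRegularity

theorem laplacian_eq (hreg : PoissonRegularity M φ ψ Γ p r q) (θ : Param d) :
    Laplacian.laplacian ψ θ = 2 * φ θ
      - inner ℝ (∇ (fun θ' => Real.log (M.posterior θ')) θ) (∇ ψ θ) - 2 * M.posteriorMean φ := by
  have h := hreg.poisson θ
  unfold Model.generator at h
  linarith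

/-- Here the Poisson equation gains a derivative: for a $C^3$ function the Laplacian is only $C^1$ a
priori. -/
theorem laplacian_contDiff (hreg : PoissonRegularity M φ ψ Γ p r q) (hM : M.IsRegular) :
    ContDiff ℝ 2 (Laplacian.laplacian ψ) := by
  rw [funext hreg.laplacian_eq]
  exact ((contDiff_const.mul hreg.test_contDiff).sub
    ((contDiff_gradient hM.contDiff_log_posterior).inner ℝ
      (contDiff_gradient hreg.sol_contDiff))).sub contDiff_const

theorem norm_fderiv_fderiv_laplacian_le (hreg : PoissonRegularity M φ ψ Γ p r q)
    (hM : M.IsRegular) (θ : Param d) :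
    ‖fderiv ℝ (fderiv ℝ (Laplacian.laplacian ψ)) θ‖ ≤ 2 * ‖iteratedFDeriv ℝ 2 φ θ‖
      + (‖iteratedFDeriv ℝ 1 (fun θ' => Real.log (M.posterior θ')) θ‖ * ‖iteratedFDeriv ℝ 3 ψ θ‖
        + 2 * ‖iteratedFDeriv ℝ 2 (fun θ' => Real.log (M.posterior θ')) θ‖
          * ‖iteratedFDeriv ℝ 2 ψ θ‖
        + ‖iteratedFDeriv ℝ 3 (fun θ' => Real.log (M.posterior θ')) θ‖
          * ‖iteratedFDeriv ℝ 1 ψ θ‖) := by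
  have hI : ContDiff ℝ 2 fun θ => inner ℝ (∇ (fun θ' => Real.log (M.posterior θ')) θ) (∇ ψ θ) :=
    (contDiff_gradient hM.contDiff_log_posterior).inner ℝ (contDiff_gradient hreg.sol_contDiff)
  have he : Laplacian.laplacian ψ = ((2 : ℝ) • φ)
      - (fun θ => inner ℝ (∇ (fun θ' => Real.log (M.posterior θ')) θ) (∇ ψ θ))
      - fun _ => 2 * M.posteriorMean φ := funext hreg.laplacian_eq
  have hφ : ContDiff ℝ 2 ((2 : ℝ) • φ) := contDiff_const.smul hreg.test_contDiff
  have hφI : ContDiff ℝ 2 (((2 : ℝ) • φ)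
      - fun θ => inner ℝ (∇ (fun θ' => Real.log (M.posterior θ')) θ) (∇ ψ θ)) := hφ.sub hI
  rw [norm_fderiv_fderiv, he, iteratedFDeriv_sub_apply hφI.contDiffAt contDiffAt_const,
    iteratedFDeriv_sub_apply hφ.contDiffAt hI.contDiffAt,
    iteratedFDeriv_const_of_ne (by norm_num), Pi.zero_apply, sub_zero,
    iteratedFDeriv_const_smul_apply hreg.test_contDiff.contDiffAt]
  refine (norm_sub_le _ _).trans (add_le_add ?_ ?_)
  · rw [norm_smul]; simp
  · exact norm_iteratedFDeriv_inner_gradient_le hM.contDiff_log_posterior hreg.sol_contDiff θ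

theorem momentOrder_pos (hreg : PoissonRegularity M φ ψ Γ p r q) : 0 < momentOrder p r q := by
  have h1 := hreg.r_pos
  have h2 := hreg.q_pos
  have h3 := le_max_right (⨆ k, p k) r
  unfold momentOrder
  linarith

/-- The function `1 + Γ` is controlled along segments. -/
theorem exists_segment_le (hreg : PoissonRegularity M φ ψ Γ p r q) :
    ∃ κ : ℝ, 1 ≤ κ ∧ ∀ θ u : Param d, ∀ c ∈ Set.Icc (0 : ℝ) 1,
      1 + Γ (θ + c • u) ≤ κ * max (1 + Γ θ) (1 + Γ (θ + u)) := by
  have hR := hreg.momentOrder_pos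
  set R := momentOrder p r q
  obtain ⟨C, hC⟩ := hreg.dom_segment R hR le_rfl
  -- The segment condition at the top exponent `R` bounds $\Gamma^R$ by $2|C|$ times the $R$-th
  -- power of the maximum; `k` is the $R$-th root. The condition excludes the endpoints of the
  -- segment, which are treated separately.
  set k := (2 * |C|) ^ (1 / R) with hk
  have hk0 : 0 ≤ k := by positivity
  refine ⟨1 + k, by linarith, fun θ u c hc => ?_⟩
  have hm1 := le_max_left (1 + Γ θ) (1 + Γ (θ + u))
  have hm2 := le_max_right (1 + Γ θ) (1 + Γ (θ + u))
  have g1 := hreg.dom_nonneg θ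
  have g2 := hreg.dom_nonneg (θ + u)
  set m := max (1 + Γ θ) (1 + Γ (θ + u))
  have hkm : 0 ≤ k * m := mul_nonneg hk0 (by linarith)
  rcases hc.1.eq_or_lt with h0 | h0
  · rw [← h0, zero_smul, add_zero]; linarith
  rcases hc.2.eq_or_lt with h1 | h1
  · rw [h1, one_smul]; linarith
  have hseg := hC (θ + u) θ c ⟨h0, h1⟩
  have e : c • (θ + u) + (1 - c) • θ = θ + c • u := by module
  rw [e] at hseg
  have hm0 : 0 ≤ m := by linarith
  have b1 : Γ θ ^ R ≤ m ^ R := Real.rpow_le_rpow g1 (by linarith) hR.le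
  have b2 : Γ (θ + u) ^ R ≤ m ^ R := Real.rpow_le_rpow g2 (by linarith) hR.le
  have hle : Γ (θ + c • u) ^ R ≤ (k * m) ^ R := by
    rw [Real.mul_rpow hk0 hm0, hk, ← Real.rpow_mul (by positivity), one_div_mul_cancel hR.ne',
      Real.rpow_one]
    have b3 : 0 ≤ Γ θ ^ R := Real.rpow_nonneg g1 _
    have b4 : 0 ≤ Γ (θ + u) ^ R := Real.rpow_nonneg g2 _
    calc _ ≤ C * (Γ (θ + u) ^ R + Γ θ ^ R) := hseg
      _ ≤ |C| * (Γ (θ + u) ^ R + Γ θ ^ R) :=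
        mul_le_mul_of_nonneg_right (le_abs_self C) (by linarith)
      _ ≤ |C| * (m ^ R + m ^ R) := by gcongr
      _ = _ := by ring
  have hfin := (Real.rpow_le_rpow_iff (hreg.dom_nonneg _) hkm hR).1 hle
  linarith

theorem rpow_le_one_add_rpow (hreg : PoissonRegularity M φ ψ Γ p r q) {s t : ℝ} (hs : 0 ≤ s)
    (hst : s ≤ t) (θ : Param d) : Γ θ ^ s ≤ (1 + Γ θ) ^ t := by
  have g := hreg.dom_nonneg θ
  exact (Real.rpow_le_rpow g (by linarith) hs).trans
    (Real.rpow_le_rpow_of_exponent_le (by linarith) hst)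

theorem exists_sol_le (hreg : PoissonRegularity M φ ψ Γ p r q) :
    ∃ C : ℝ, 0 ≤ C ∧ ∀ k : ℕ, k < 4 → ∀ θ,
      ‖iteratedFDeriv ℝ k ψ θ‖ ≤ C * (1 + Γ θ) ^ max (⨆ k, p k) r := by
  choose C hC using hreg.sol_growth
  obtain ⟨D, hD⟩ := Finite.exists_le C
  refine ⟨|D|, abs_nonneg D, fun k hk θ => ?_⟩
  have hp : p ⟨k, hk⟩ ≤ max (⨆ k, p k) r :=
    (le_ciSup (Finite.bddAbove_range p) ⟨k, hk⟩).trans (le_max_left _ _)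
  have hΓ : 0 ≤ Γ θ ^ p ⟨k, hk⟩ := Real.rpow_nonneg (hreg.dom_nonneg θ) _
  calc _ ≤ C ⟨k, hk⟩ * Γ θ ^ p ⟨k, hk⟩ := hC ⟨k, hk⟩ θ
    _ ≤ |D| * Γ θ ^ p ⟨k, hk⟩ :=
      mul_le_mul_of_nonneg_right ((hD _).trans (le_abs_self D)) hΓ
    _ ≤ _ := mul_le_mul_of_nonneg_left
      (hreg.rpow_le_one_add_rpow (hreg.p_pos _).le hp θ) (abs_nonneg D)

theorem le_of_le_one_add_rpow (hreg : PoissonRegularity M φ ψ Γ p r q) {x C s t : ℝ} (hs : 0 ≤ s)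
    (hst : s ≤ t) {θ : Param d} (hx : x ≤ C * (1 + Γ θ ^ s)) :
    x ≤ 2 * |C| * (1 + Γ θ) ^ t := by
  have g := hreg.dom_nonneg θ
  have h1 := hreg.rpow_le_one_add_rpow hs hst θ
  have h2 : 1 ≤ (1 + Γ θ) ^ t := Real.one_le_rpow (by linarith) (hs.trans hst)
  have h3 : 0 ≤ Γ θ ^ s := Real.rpow_nonneg g _
  calc _ ≤ C * (1 + Γ θ ^ s) := hx
    _ ≤ |C| * (1 + Γ θ ^ s) := mul_le_mul_of_nonneg_right (le_abs_self C) (by linarith)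
    _ ≤ |C| * ((1 + Γ θ) ^ t + (1 + Γ θ) ^ t) := by gcongr
    _ = _ := by ring

theorem exists_logPosterior_le (hreg : PoissonRegularity M φ ψ Γ p r q) :
    ∃ C : ℝ, 0 ≤ C ∧ ∀ k : ℕ, 1 ≤ k → k ≤ 3 → ∀ θ,
      ‖iteratedFDeriv ℝ k (fun θ' => Real.log (M.posterior θ')) θ‖ ≤ C * (1 + Γ θ) ^ q := by
  have h : ∀ k : Fin 3, ∃ C : ℝ, ∀ θ,
      ‖iteratedFDeriv ℝ (k + 1 : ℕ) (fun θ' => Real.log (M.posterior θ')) θ‖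
        ≤ C * (1 + Γ θ ^ q) := fun k => hreg.logPosterior_growth (k + 1) (by omega) (by omega)
  choose C hC using h
  obtain ⟨D, hD⟩ := Finite.exists_le C
  refine ⟨2 * |D|, by positivity, fun k hk1 hk3 θ => ?_⟩
  obtain ⟨k, rfl⟩ := Nat.exists_eq_add_of_le' hk1
  refine hreg.le_of_le_one_add_rpow hreg.q_pos.le le_rfl ((hC ⟨k, by omega⟩ θ).trans ?_)
  exact mul_le_mul_of_nonneg_right (hD _)
    (by linarith [Real.rpow_nonneg (hreg.dom_nonneg θ) q])

/-- The growth conditions in terms of the single weight `1 + Γ`. -/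
theorem exists_growthBounds (hreg : PoissonRegularity M φ ψ Γ p r q) (hM : M.IsRegular)
    {β : Type*} [Finite β] {v : β → Param d → Param d} (hv : ∀ b, Continuous (v b))
    (hvb : ∀ b, ∃ c : ℝ, ∀ θ, ‖v b θ - ∇ (fun θ' => Real.log (M.posterior θ')) θ‖ ≤ c) :
    ∃ A κ : ℝ, GrowthBounds (fun θ => 1 + Γ θ) ψ (Laplacian.laplacian ψ) v A κ
      (max (⨆ k, p k) r + q) q := by
  obtain ⟨κ, hκ, hseg⟩ := hreg.exists_segment_le
  obtain ⟨C₁, hC₁, hsol⟩ := hreg.exists_sol_le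
  obtain ⟨C₂, hC₂, hlog⟩ := hreg.exists_logPosterior_le
  obtain ⟨C₃, htest⟩ := hreg.test_growth
  set C₄ : ℝ := (Module.finrank ℝ (Param d) : ℝ)
  have hC₄ : 0 ≤ C₄ := Nat.cast_nonneg _
  choose c hc using hvb
  obtain ⟨C₅, hC₅⟩ := Finite.exists_le c
  have hr := hreg.r_pos
  have hq := hreg.q_pos
  set a := max (⨆ k, p k) r with ha
  have hra : r ≤ a := le_max_right _ _
  have hΓ := hreg.dom_nonneg
  have hW1 : ∀ θ, 1 ≤ 1 + Γ θ := fun θ => by linarith [hΓ θ]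
  have hWq : ∀ θ, 1 ≤ (1 + Γ θ) ^ q := fun θ => Real.one_le_rpow (hW1 θ) hq.le
  have hWa : ∀ θ, (1 + Γ θ) ^ a ≤ (1 + Γ θ) ^ (a + q) := fun θ =>
    Real.rpow_le_rpow_of_exponent_le (hW1 θ) (by linarith)
  have hpos : ∀ θ (s : ℝ), 0 ≤ (1 + Γ θ) ^ s := fun θ s => Real.rpow_nonneg (by linarith [hW1 θ]) s
  -- One summand per kind of bound: `ψ` and its derivatives, the Laplacian and its gradient, the
  -- Hessian of the Laplacian, the drift. Products of derivatives of the log-posterior and of `ψ`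
  -- make the exponent `max (⨆ k, p k) r + q`.
  set A := 1 + C₁ + C₄ * C₁ + (2 * (2 * |C₃|) + 4 * (C₂ * C₁)) + (|C₅| + C₂) with hA
  have hC₁₂ : 0 ≤ C₂ * C₁ := mul_nonneg hC₂ hC₁
  have hC₄₁ : 0 ≤ C₄ * C₁ := mul_nonneg hC₄ hC₁
  have hC₃0 : 0 ≤ |C₃| := abs_nonneg _
  have hC₅0 : 0 ≤ |C₅| := abs_nonneg _
  have hle : ∀ {x C : ℝ} {θ}, C ≤ A → 0 ≤ C → x ≤ C * (1 + Γ θ) ^ a →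
      x ≤ A * (1 + Γ θ) ^ (a + q) := fun {x C θ} hCA hC0 hx =>
    hx.trans (mul_le_mul hCA (hWa θ) (hpos θ a) (hC0.trans hCA))
  have hA1 : C₁ ≤ A := by linarith
  have hA2 : C₄ * C₁ ≤ A := by linarith
  have hscale : ∀ {x y : ℝ} {θ}, x ≤ C₄ * y → y ≤ C₁ * (1 + Γ θ) ^ a →
      x ≤ C₄ * C₁ * (1 + Γ θ) ^ a := fun {x y θ} hx hy =>
    hx.trans ((mul_le_mul_of_nonneg_left hy hC₄).trans_eq (by ring))
  refine ⟨A, κ, {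
    one_le_A := by linarith
    one_le_κ := hκ
    a_pos := by linarith
    q_pos := hq
    one_le := hW1
    measurable := hreg.dom_measurable.const_add 1
    segment := hseg
    sol_contDiff := hreg.sol_contDiff.of_le (by norm_num)
    lap_contDiff := hreg.laplacian_contDiff hM
    lap_eq := fun _ => rfl
    sol_le := fun θ => hle hA1 hC₁ (by simpa using hsol 0 (by norm_num) θ)
    fderiv_sol_le := fun θ => hle hA1 hC₁ (by
      rw [← norm_iteratedFDeriv_one]; exact hsol 1 (by norm_num) θ)
    fderiv_fderiv_sol_le := fun θ => hle hA1 hC₁ (by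
      rw [norm_fderiv_fderiv]; exact hsol 2 (by norm_num) θ)
    lap_le := fun θ => hle hA2 hC₄₁
      (hscale (abs_laplacian_le ψ θ) (hsol 2 (by norm_num) θ))
    fderiv_lap_le := fun θ => hle hA2 hC₄₁
      (hscale (norm_fderiv_laplacian_le hreg.sol_contDiff θ) (hsol 3 (by norm_num) θ))
    fderiv_fderiv_lap_le := fun θ => ?_
    drift_continuous := hv
    drift_le := fun b θ => ?_ }⟩
  · refine (hreg.norm_fderiv_fderiv_laplacian_le hM θ).trans ?_
    have ht := hreg.le_of_le_one_add_rpow hr.le (hra.trans (by linarith : a ≤ a + q)) (htest θ)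
    have hprod : ∀ k, 1 ≤ k → k ≤ 3 → ∀ l, l < 4 →
        ‖iteratedFDeriv ℝ k (fun θ' => Real.log (M.posterior θ')) θ‖ * ‖iteratedFDeriv ℝ l ψ θ‖
          ≤ C₂ * C₁ * (1 + Γ θ) ^ (a + q) := by
      intro k hk1 hk3 l hl
      refine (mul_le_mul (hlog k hk1 hk3 θ) (hsol l hl θ) (norm_nonneg _)
        (mul_nonneg hC₂ (hpos θ q))).trans_eq ?_
      rw [Real.rpow_add (by linarith [hW1 θ])]
      ring
    have h1 := hprod 1 le_rfl (by norm_num) 3 (by norm_num)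
    have h2 := hprod 2 (by norm_num) (by norm_num) 2 (by norm_num)
    have h3 := hprod 3 (by norm_num) le_rfl 1 (by norm_num)
    calc _ ≤ (2 * (2 * |C₃|) + 4 * (C₂ * C₁)) * (1 + Γ θ) ^ (a + q) := by linarith
      _ ≤ _ := mul_le_mul_of_nonneg_right (by linarith) (hpos θ _)
  · have h1 : ‖∇ (fun θ' => Real.log (M.posterior θ')) θ‖ ≤ C₂ * (1 + Γ θ) ^ q := by
      have := hlog 1 le_rfl (by norm_num) θ
      rwa [← zero_add 1, ← norm_iteratedFDeriv_gradient, norm_iteratedFDeriv_zero] at this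
    have h2 : ‖v b θ - ∇ (fun θ' => Real.log (M.posterior θ')) θ‖ ≤ |C₅| * (1 + Γ θ) ^ q :=
      (hc b θ).trans (((hC₅ b).trans (le_abs_self _)).trans
        (le_mul_of_one_le_right (abs_nonneg _) (hWq θ)))
    calc ‖v b θ‖ = ‖(v b θ - ∇ (fun θ' => Real.log (M.posterior θ')) θ)
          + ∇ (fun θ' => Real.log (M.posterior θ')) θ‖ := by rw [sub_add_cancel]
      _ ≤ |C₅| * (1 + Γ θ) ^ q + C₂ * (1 + Γ θ) ^ q := (norm_add_le _ _).trans (add_le_add h2 h1)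
      _ = (|C₅| + C₂) * (1 + Γ θ) ^ q := by ring
      _ ≤ _ := mul_le_mul_of_nonneg_right (by linarith) (hpos θ _)

end PoissonRegularity

end Growth

/-! ### Conclusion for unbiased estimators with bounded error. -/

section Main

variable {d S : ℕ} {𝒳 : Type*} {M : Model d S 𝒳} {φ ψ Γ : Param d → ℝ} {p : Fin 4 → ℝ} {r q : ℝ}

theorem one_add_rpow_le {x s : ℝ} (hx : 0 ≤ x) (hs : 0 ≤ s) :
    (1 + x) ^ s ≤ 2 ^ s * (1 + x ^ s) := by
  have h1 : 0 ≤ x ^ s := Real.rpow_nonneg hx s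
  have h2 : (0 : ℝ) ≤ 2 ^ s := Real.rpow_nonneg (by norm_num) s
  rcases le_total x 1 with h | h
  · calc (1 + x) ^ s ≤ 2 ^ s := Real.rpow_le_rpow (by linarith) (by linarith) hs
      _ ≤ _ := le_mul_of_one_le_right h2 (by linarith)
  · calc (1 + x) ^ s ≤ (2 * x) ^ s := Real.rpow_le_rpow (by linarith) (by linarith) hs
      _ = 2 ^ s * x ^ s := Real.mul_rpow (by norm_num) hx
      _ ≤ _ := mul_le_mul_of_nonneg_left (by linarith) h2

theorem sampleAverage_sub_const {Ω : Type*} (φ : Param d → ℝ) (c : ℝ) (θ : ℕ → Ω → Param d) {T : ℕ}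
    (hT : 0 < T) (ω : Ω) :
    sampleAverage (fun θ => φ θ - c) θ T ω = sampleAverage φ θ T ω - c := by
  have : (T : ℝ) ≠ 0 := Nat.cast_ne_zero.2 hT.ne'
  simp only [sampleAverage, Finset.sum_sub_distrib, Finset.sum_const, Nat.card_Icc,
    add_tsub_cancel_right, nsmul_eq_mul, mul_sub]
  rw [inv_mul_cancel_left₀ this]

/-- The mean square error of a Langevin chain whose gradient estimator is unbiased and has a bounded
error. -/
theorem exists_mean_square_error_le (hM : M.IsRegular) (hreg : PoissonRegularity M φ ψ Γ p r q)
    {H : Set ℝ} (hH : ∀ h ∈ H, 0 < h) {Ω : Type*} [MeasurableSpace Ω] {P : Measure Ω}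
    [IsProbabilityMeasure P] {θ₀ : Ω → Param d} {Z : ℕ → Ω → Param d} {β : Type*} [Fintype β]
    [MeasurableSpace β] [MeasurableSingletonClass β] {w : β → ℝ} {B : ℕ → Ω → β}
    {v : β → Param d → Param d} (hN : IsDrivingNoise P w θ₀ B Z)
    (hmom : MomentsBounded P Γ (momentOrder p r q) H (chain v θ₀ B Z))
    (hv : ∀ b, Continuous (v b))
    (hvb : ∀ b, ∃ c : ℝ, ∀ θ, ‖v b θ - ∇ (fun θ' => Real.log (M.posterior θ')) θ‖ ≤ c)
    (hunbiased : ∀ θ, ∑ b, w b • v b θ = ∇ (fun θ' => Real.log (M.posterior θ')) θ) :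
    ∃ C : ℝ, 0 < C ∧ ∀ h ∈ H, ∀ T : ℕ, 0 < T → ∀ D : ℝ, 0 ≤ D →
      Integrable (fun ω => (sampleAverage φ (chain v θ₀ B Z h) T ω - M.posteriorMean φ) ^ 2) P ∧
      ∫ ω, (sampleAverage φ (chain v θ₀ B Z h) T ω - M.posteriorMean φ) ^ 2 ∂P
        ≤ C * (D + 1 / (h * T) + h ^ 2) := by
  obtain ⟨A, κ, hW⟩ := hreg.exists_growthBounds hM hv hvb
  have hπ := Measure.isProbabilityMeasure_map (μ := P) (hN.measurable_batch 0).aemeasurable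
  have hdrift : ∀ θ, ∫ b, v b θ ∂(P.map (B 0)) = ∇ (fun θ' => Real.log (M.posterior θ')) θ := by
    intro θ
    rw [integral_fintype .of_finite, ← hunbiased]
    refine Finset.sum_congr rfl fun b _ => ?_
    rw [map_measureReal_apply (hN.measurable_batch 0) (measurableSet_singleton b), hN.batch_law]
  have hR := hreg.momentOrder_pos
  obtain ⟨K, hK⟩ := hmom _ hR le_rfl
  -- With exponent $a=\max+q$, the second moment of $W^{a+2q}$ has order $2a+4q=2\max+6q$, exactly
  -- the controlled order.
  have hRe : 2 * (max (⨆ k, p k) r + q) + 4 * q = momentOrder p r q := by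
    unfold momentOrder; ring
  have hmomW : ∀ h ∈ H, ∀ t, Integrable (fun ω => (1 + Γ (chain v θ₀ B Z h t ω))
      ^ (2 * (max (⨆ k, p k) r + q) + 4 * q)) P ∧
      ∫ ω, (1 + Γ (chain v θ₀ B Z h t ω)) ^ (2 * (max (⨆ k, p k) r + q) + 4 * q) ∂P
        ≤ 2 ^ momentOrder p r q * (1 + K) := by
    intro h hh t
    rw [hRe]
    obtain ⟨hi, hle⟩ := hK h hh t
    have hΓ := fun ω => hreg.dom_nonneg (chain v θ₀ B Z h t ω)
    have hdom : Integrable (fun ω => 2 ^ momentOrder p r q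
        * (1 + Γ (chain v θ₀ B Z h t ω) ^ momentOrder p r q)) P :=
      ((integrable_const 1).add hi).const_mul _
    have hintg : Integrable (fun ω => (1 + Γ (chain v θ₀ B Z h t ω)) ^ momentOrder p r q) P := by
      refine hdom.mono' (((hreg.dom_measurable.comp
        (hW.measurable_chain hN h t)).const_add 1).pow_const _).aestronglyMeasurable
        (ae_of_all _ fun ω => ?_)
      rw [Real.norm_of_nonneg (Real.rpow_nonneg (by linarith [hΓ ω]) _)]
      exact one_add_rpow_le (hΓ ω) hR.le
    refine ⟨hintg, (integral_mono hintg hdom fun ω => one_add_rpow_le (hΓ ω) hR.le).trans ?_⟩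
    rw [integral_const_mul, integral_add (integrable_const _) hi]
    refine mul_le_mul_of_nonneg_left ?_ (Real.rpow_nonneg (by norm_num) _)
    simpa using hle
  have hg : ∀ θ, φ θ - M.posteriorMean φ
      = 1 / 2 * (fderiv ℝ ψ θ (∫ b, v b θ ∂(P.map (B 0))) + Laplacian.laplacian ψ θ) := by
    intro θ
    rw [← hreg.poisson θ, hdrift, Model.generator, real_inner_comm, inner_gradient_left]
    ring
  obtain ⟨C, hC, hbound⟩ := hW.exists_mean_square_average_le hN hH hmomW hg
  refine ⟨C, hC, fun h hh T hT D hD => ?_⟩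
  obtain ⟨h1, h2⟩ := hbound h hh T hT
  simp only [sampleAverage_sub_const φ _ _ hT] at h1 h2
  refine ⟨h1, h2.trans (mul_le_mul_of_nonneg_left ?_ hC.le)⟩
  -- The bound without `D` is already proved, and `D` is nonnegative.
  linarith

end Main

end DSGLD

end

theorem theorem1 {d S : ℕ} {𝒳 : Type*} (M : DSGLD.Model d S 𝒳) (hM : M.IsRegular)
    (f : Fin S → ℝ) (hf_pos : ∀ s, 0 < f s) (hf_sum : ∑ s, f s = 1)
    (m : ℕ) (hm : 0 < m)
    (γ : Fin S → ℝ) (hγ : ∀ s i θ, ‖M.gradLogLik (M.x s i) θ‖ ≤ γ s)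
    (φ ψ Γ : DSGLD.Param d → ℝ) (p : Fin 4 → ℝ) (r q : ℝ)
    (hreg : DSGLD.PoissonRegularity M φ ψ Γ p r q)
    (H : Set ℝ) (hH : ∀ h ∈ H, 0 < h)
    {Ω : Type*} [MeasurableSpace Ω] (P : MeasureTheory.Measure Ω)
    [MeasureTheory.IsProbabilityMeasure P]
    (θ₀ : Ω → DSGLD.Param d) (Z : ℕ → Ω → DSGLD.Param d) :
    -- the bound for DSGLD
    (∀ B : ℕ → Ω → M.ShardBatch m,
      DSGLD.IsDrivingNoise P (M.shardBatchProb f m) θ₀ B Z →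
      DSGLD.MomentsBounded P Γ (DSGLD.momentOrder p r q) H
        (DSGLD.chain (M.dsgldEstimator f m) θ₀ B Z) →
      ∃ C : ℝ, 0 < C ∧ ∀ h ∈ H, ∀ T : ℕ, 0 < T →
        MeasureTheory.Integrable (fun ω =>
          (DSGLD.sampleAverage φ (DSGLD.chain (M.dsgldEstimator f m) θ₀ B Z h) T ω
            - M.posteriorMean φ) ^ 2) P ∧
        ∫ ω, (DSGLD.sampleAverage φ (DSGLD.chain (M.dsgldEstimator f m) θ₀ B Z h) T ω
            - M.posteriorMean φ) ^ 2 ∂P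
          ≤ C * ((∑ s, (M.N s : ℝ) ^ 2 / f s * γ s ^ 2) / (m * T) + 1 / (h * T) + h ^ 2)) ∧
    -- all shards merged into one: the bound for SGLD
    (∀ B : ℕ → Ω → M.MergedBatch m,
      DSGLD.IsDrivingNoise P (M.mergedBatchProb m) θ₀ B Z →
      DSGLD.MomentsBounded P Γ (DSGLD.momentOrder p r q) H
        (DSGLD.chain (M.sgldEstimator m) θ₀ B Z) →
      ∀ γ' : ℝ, (∀ s, γ s ≤ γ') →
      ∃ C : ℝ, 0 < C ∧ ∀ h ∈ H, ∀ T : ℕ, 0 < T →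
        MeasureTheory.Integrable (fun ω =>
          (DSGLD.sampleAverage φ (DSGLD.chain (M.sgldEstimator m) θ₀ B Z h) T ω
            - M.posteriorMean φ) ^ 2) P ∧
        ∫ ω, (DSGLD.sampleAverage φ (DSGLD.chain (M.sgldEstimator m) θ₀ B Z h) T ω
            - M.posteriorMean φ) ^ 2 ∂P
          ≤ C * ((M.total : ℝ) ^ 2 * γ' ^ 2 / (m * T) + 1 / (h * T) + h ^ 2)) := by
  constructor
  · intro B hN hmom
    obtain ⟨C, hC, hbound⟩ := DSGLD.exists_mean_square_error_le hM hreg hH hN hmom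
      (hM.continuous_dsgldEstimator f m)
      -- A batch from one shard is read as a batch of pairs with constant first entry.
      (fun b => ⟨_, fun θ => DSGLD.Model.norm_prior_add_smul_sum_sub_posterior_le hM hγ
        ((M.N b.1 : ℝ) / (f b.1 * m)) (fun j => ⟨b.1, b.2 j⟩) θ⟩)
      (hM.sum_dsgldEstimator hf_pos hf_sum hm)
    refine ⟨C, hC, fun h hh T hT => hbound h hh T hT _ ?_⟩
    exact div_nonneg (Finset.sum_nonneg fun s _ =>
      mul_nonneg (div_nonneg (sq_nonneg _) (hf_pos s).le) (sq_nonneg _)) (by positivity)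
  · intro B hN hmom γ' _
    -- With no shards the probabilities would sum to 0 instead of 1.
    have hS : 0 < S := by
      rcases Nat.eq_zero_or_pos S with rfl | hS
      · simp at hf_sum
      · exact hS
    obtain ⟨C, hC, hbound⟩ := DSGLD.exists_mean_square_error_le hM hreg hH hN hmom
      (hM.continuous_sgldEstimator m)
      (fun b => ⟨_, fun θ => DSGLD.Model.norm_prior_add_smul_sum_sub_posterior_le hM hγ
        ((M.total : ℝ) / m) b θ⟩)
      (hM.sum_sgldEstimator hS hm)
    exact ⟨C, hC, fun h hh T hT => hbound h hh T hT _ (by positivity)⟩
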